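/- Let $n\ge 1$ be an integer, let $\alpha>n$ be real, and let $f:\mathbb R^n\to\mathbb R$ be a non-negative function in $L^1(\mathbb R^n)\cap L^\infty(\mathbb R^n)$ that is non-zero, i.e. $\{f\neq 0\}$ has positive Lebesgue measure. Put $$\sigma_{n,\alpha}=\frac{n\,2^{\alpha}\,\pi^{\frac{n-\alpha-1}{2}}\,\Gamma\!\left(\frac{\alpha+1}{2}\right)\Gamma\!\left(\frac n2+1\right)^{\frac{\alpha}{n}}}{|\alpha|\,\Gamma\!\left(\frac{n+\alpha}{2}+1\right)}.$$ Then $$\sigma_{n,\alpha}\,\|f\|_1^{\frac{n+\alpha}{n}}\,\|f\|_\infty^{-\frac{\alpha}{n}}\;\le\;\int_{\mathbb R^n}\int_{\mathbb R^n}\min\{f(x),f(y)\}\,|x-y|^{\alpha-n}\,dx\,dy ,$$ where $|\cdot|$ is the Euclidean norm, $\|\cdot\|_1$ and $\|\cdot\|_\infty$ are the $L^1$ norm and the essential supremum norm with respect to Lebesgue measure, and the right-hand side may be $+\infty$. Equality holds if and only if there are a constant $c>0$ and a ball $B\subset\mathbb R^n$ of positive radius such that $f=c\,\chi_B$ almost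 everywhere, where $\chi_B$ is the characteristic function of $B$. -/

import Mathlib

open MeasureTheory
open scoped ENNReal

/-- The sharp constant
`σ_{n,α} = n 2^α π^((n-α-1)/2) Γ((α+1)/2) Γ(n/2+1)^(α/n) / (|α| Γ((n+α)/2+1))`. -/
noncomputable def chordSobolevConst (n : ℕ) (α : ℝ) : ℝ :=
  ((n : ℝ) * 2 ^ α * Real.pi ^ (((n : ℝ) - α - 1) / 2) * Real.Gamma ((α + 1) / 2) *
      Real.Gamma ((n : ℝ) / 2 + 1) ^ (α / (n : ℝ))) /
    (|α| * Real.Gamma (((n : ℝ) + α) / 2 + 1))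

/-- The energy `∬ min{f(x), f(y)} |x - y|^(α - n) dx dy ∈ [0, ∞]` of a non-negative function `f`
on Euclidean `n`-space (meant for `α > n`, where the kernel has no singularity). -/
noncomputable def minEnergy (n : ℕ) (α : ℝ) (f : EuclideanSpace ℝ (Fin n) → ℝ) : ℝ≥0∞ :=
  ∫⁻ x, ∫⁻ y, ENNReal.ofReal (min (f x) (f y) * ‖x - y‖ ^ (α - (n : ℝ)))

/-!
Write the energy of `f` by the layer cake formula as the integral over `t > 0` of the energies
`I(A_t)` of the superlevel sets `A_t = {f > t}`, where `I(A) = ∫_A ∫_A |x - y|^(α - n) dy dx`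
(`minEnergy_eq_lintegral_rieszEnergy`). Two facts finish the proof.

* *Riesz's inequality for an increasing kernel*: `I(A) ≥ σ_{n,α} |A|^(1 + α/n)`, with equality only
  for balls. (`chordSobolevConst_mul_volume_rpow_le_rieszEnergy`,
  `exists_ae_eq_closedBall_of_rieszEnergy_le`)
* *Jensen's inequality* for `s ↦ s ^ (1 + α/n)` on the interval `(0, ‖f‖_∞)`, over which the
  volumes `|A_t|` integrate to `‖f‖_1`; equality forces `|A_t|` to be constant.
  (`measure_univ_le_lintegral_rpow`)

In case of equality almost all `A_t` with `t < ‖f‖_∞` are balls of the same volume, hence, being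
nested, the same ball up to null sets (`ae_eq_indicator_closedBall_of_superlevel`).

Riesz's inequality is proved by polarization, i.e. by reflecting in a hyperplane those points of `A`
on one side of it whose mirror image is not in `A`. This preserves volume and does not increase the
energy, and it strictly lowers a finite energy unless all unmatched points lie on one side
(`rieszEnergy_polarization_le`, `volume_unmatched_eq_zero_of_le`). For bounded `A` and the centred
ball `B` of the same volume, averaging over all hyperplanes yields a polarization which increases
`|A ∩ B|` by at least a fixed multiple of `|A \ B|²` (`volume_mul_volume_le_of_overlap_le`), so the
sets obtainable from `A` come arbitrarily close to `B`, without any compactness argument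
(`exists_rieszEnergy_le_volume_sdiff_le`). If `A` is a minimizer, the one-sidedness for the
hyperplanes that halve `A` makes `A` symmetric about `n` orthogonal hyperplanes, hence about a
point, which may be taken as the origin. For any hyperplane off the origin the unmatched points
then lie on the side of the origin, so no reflection maps `A \ B` into `B \ A`, and the averaging
argument gives `|A \ B| = 0`.

The constant is the energy of a ball (`rieszEnergy_closedBall`). The ball `B` meets its translate by
`z` in a set with the volume of two caps `{x ∈ B | |⟪z, x⟫| > |z|²/2}`; polar coordinates in `z`
reduce the energy to the moments `∫_B |⟪θ, x⟫|^α dx`, which are computed by comparison with the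
Gaussian weight `exp (-|x|²)`.
-/

set_option linter.unusedSectionVars false

/-! ### Reflections in hyperplanes -/

section Reflection

variable {E : Type*} [NormedAddCommGroup E] [InnerProductSpace ℝ E]

/-- The reflection in the hyperplane `{x | ⟪e, x⟫ = t}`, for a unit vector `e`. -/
noncomputable def hyperplaneReflection (e : E) (t : ℝ) (x : E) : E :=
  x + (2 * (t - inner ℝ e x)) • e

lemma inner_hyperplaneReflection {e : E} (he : ‖e‖ = 1) (t : ℝ) (x : E) :
    inner ℝ e (hyperplaneReflection e t x) = 2 * t - inner ℝ e x := by
  simp only [hyperplaneReflection, inner_add_right, inner_smul_right,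
    real_inner_self_eq_norm_sq, he]
  ring

lemma hyperplaneReflection_involutive {e : E} (he : ‖e‖ = 1) (t : ℝ) :
    Function.Involutive (hyperplaneReflection e t) := by
  intro x
  rw [hyperplaneReflection, inner_hyperplaneReflection he, hyperplaneReflection, add_assoc,
    ← add_smul]
  ring_nf
  simp

lemma norm_sub_hyperplaneReflection_sq {e : E} (he : ‖e‖ = 1) (t : ℝ) (x y : E) :
    ‖x - hyperplaneReflection e t y‖ ^ 2 =
      ‖x - y‖ ^ 2 - 4 * (t - inner ℝ e y) * (inner ℝ e x - t) := by
  have h : x - hyperplaneReflection e t y = (x - y) - (2 * (t - inner ℝ e y)) • e := by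
    rw [hyperplaneReflection]; abel
  rw [h, @norm_sub_sq_real, inner_smul_right, real_inner_comm e (x - y), inner_sub_right, norm_smul,
    he, mul_one, Real.norm_eq_abs, sq_abs]
  ring

lemma norm_hyperplaneReflection_sq {e : E} (he : ‖e‖ = 1) (t : ℝ) (x : E) :
    ‖hyperplaneReflection e t x‖ ^ 2 = ‖x‖ ^ 2 + 4 * t * (t - inner ℝ e x) := by
  have h := norm_sub_hyperplaneReflection_sq he t 0 x
  simp only [zero_sub, norm_neg, inner_zero_right] at h
  rw [h]; ring

lemma norm_hyperplaneReflection_sub {e : E} (he : ‖e‖ = 1) (t : ℝ) (x y : E) :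
    ‖hyperplaneReflection e t x - hyperplaneReflection e t y‖ = ‖x - y‖ := by
  refine (pow_left_inj₀ (norm_nonneg _) (norm_nonneg _) two_ne_zero).1 ?_
  rw [norm_sub_hyperplaneReflection_sq he, norm_sub_rev,
    norm_sub_hyperplaneReflection_sq he, inner_hyperplaneReflection he, norm_sub_rev]
  ring

lemma continuous_hyperplaneReflection (e : E) (t : ℝ) :
    Continuous (hyperplaneReflection e t) := by
  unfold hyperplaneReflection
  fun_prop

lemma measurePreserving_hyperplaneReflection [FiniteDimensional ℝ E] [MeasurableSpace E]
    [BorelSpace E] {e : E} (he : ‖e‖ = 1) (t : ℝ) :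
    MeasurePreserving (hyperplaneReflection e t) := by
  have h : hyperplaneReflection e t =
      (fun x => x + (2 * t) • e) ∘ ((ℝ ∙ e)ᗮ.reflection : E → E) := by
    funext x
    simp only [Function.comp_apply, Submodule.reflection_orthogonal_apply,
      Submodule.reflection_singleton_apply, he, hyperplaneReflection]
    simp only [RCLike.ofReal_one, one_pow, div_one, mul_sub, sub_smul, mul_smul]
    simp only [ofNat_smul_eq_nsmul, two_smul]
    abel
  rw [h]
  exact (measurePreserving_add_right _ _).comp (LinearIsometryEquiv.measurePreserving _)

end Reflection

/-! ### The energy of sets under polarization -/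

section Energy

variable {E : Type*} [NormedAddCommGroup E] [InnerProductSpace ℝ E] [FiniteDimensional ℝ E]
  [MeasurableSpace E] [BorelSpace E]

/-- The mutual energy `∫_A ∫_B |x - y|^β dy dx` of two sets. -/
noncomputable def rieszEnergy (β : ℝ) (A B : Set E) : ℝ≥0∞ :=
  ∫⁻ x in A, ∫⁻ y in B, ENNReal.ofReal (‖x - y‖ ^ β)

lemma measurable_rieszKernel (β : ℝ) :
    Measurable (fun p : E × E => ENNReal.ofReal (‖p.1 - p.2‖ ^ β)) := by
  fun_prop

lemma measurable_rieszKernel_right (β : ℝ) (x : E) :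
    Measurable (fun y : E => ENNReal.ofReal (‖x - y‖ ^ β)) := by
  fun_prop

lemma measurable_rieszPotential (β : ℝ) (B : Set E) :
    Measurable (fun x : E => ∫⁻ y in B, ENNReal.ofReal (‖x - y‖ ^ β)) :=
  (measurable_rieszKernel β).lintegral_prod_right'

lemma rieszEnergy_comm (β : ℝ) (A B : Set E) : rieszEnergy β A B = rieszEnergy β B A := by
  unfold rieszEnergy
  rw [lintegral_lintegral_swap (measurable_rieszKernel β).aemeasurable]
  simp_rw [norm_sub_rev]

lemma rieszEnergy_mono (β : ℝ) {A A' B B' : Set E} (hA : A ⊆ A') (hB : B ⊆ B') :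
    rieszEnergy β A B ≤ rieszEnergy β A' B' :=
  (lintegral_mono_set hA).trans (lintegral_mono fun _ => lintegral_mono_set hB)

lemma rieszEnergy_union_left (β : ℝ) {A A' B : Set E} (hA' : MeasurableSet A')
    (h : Disjoint A A') :
    rieszEnergy β (A ∪ A') B = rieszEnergy β A B + rieszEnergy β A' B :=
  lintegral_union hA' h

lemma rieszEnergy_union_right (β : ℝ) {A B B' : Set E} (hB' : MeasurableSet B')
    (h : Disjoint B B') :
    rieszEnergy β A (B ∪ B') = rieszEnergy β A B + rieszEnergy β A B' := by
  rw [rieszEnergy_comm, rieszEnergy_union_left β hB' h, rieszEnergy_comm β B,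
    rieszEnergy_comm β B']

/-- The mutual energy is invariant under measure preserving isometries. -/
lemma rieszEnergy_preimage (β : ℝ) {φ : E → E} (hφ : MeasurePreserving φ)
    (hiso : ∀ x y, ‖φ x - φ y‖ = ‖x - y‖) {A B : Set E} (hA : MeasurableSet A)
    (hB : MeasurableSet B) :
    rieszEnergy β (φ ⁻¹' A) (φ ⁻¹' B) = rieszEnergy β A B := by
  unfold rieszEnergy
  rw [← hφ.setLIntegral_comp_preimage hA (measurable_rieszPotential β B)]
  refine lintegral_congr fun x => ?_
  rw [← hφ.setLIntegral_comp_preimage hB (measurable_rieszKernel_right β (φ x))]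
  simp_rw [hiso]

/-- The part of `A` on the side `t < ⟪e, x⟫` whose mirror image is not in `A`. -/
def upperUnmatched (e : E) (t : ℝ) (A : Set E) : Set E :=
  A ∩ ({x | t < inner ℝ e x} ∩ (hyperplaneReflection e t ⁻¹' A)ᶜ)

/-- The part of `A` on the side `⟪e, x⟫ < t` whose mirror image is not in `A`. -/
def lowerUnmatched (e : E) (t : ℝ) (A : Set E) : Set E :=
  A ∩ ({x | inner ℝ e x < t} ∩ (hyperplaneReflection e t ⁻¹' A)ᶜ)

/-- The part of `A` that is symmetric about the hyperplane `⟪e, x⟫ = t`. -/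
def matched (e : E) (t : ℝ) (A : Set E) : Set E :=
  A ∩ hyperplaneReflection e t ⁻¹' A

/-- The polarization (two-point symmetrization) of `A` towards the half-space `t < ⟪e, x⟫`:
the unmatched points on the lower side are reflected to the upper side. -/
def polarization (e : E) (t : ℝ) (A : Set E) : Set E :=
  matched e t A ∪ upperUnmatched e t A ∪ hyperplaneReflection e t ⁻¹' lowerUnmatched e t A

section Polarization

variable {e : E} {t : ℝ} {A : Set E}

lemma measurableSet_matched (hA : MeasurableSet A) : MeasurableSet (matched e t A) :=
  hA.inter ((continuous_hyperplaneReflection e t).measurable hA)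

lemma measurableSet_upperUnmatched (hA : MeasurableSet A) :
    MeasurableSet (upperUnmatched e t A) :=
  hA.inter ((measurableSet_lt measurable_const (by fun_prop)).inter
    ((continuous_hyperplaneReflection e t).measurable hA).compl)

lemma measurableSet_lowerUnmatched (hA : MeasurableSet A) :
    MeasurableSet (lowerUnmatched e t A) :=
  hA.inter ((measurableSet_lt (by fun_prop) measurable_const).inter
    ((continuous_hyperplaneReflection e t).measurable hA).compl)

lemma measurableSet_polarization (hA : MeasurableSet A) :
    MeasurableSet (polarization e t A) :=
  ((measurableSet_matched hA).union (measurableSet_upperUnmatched hA)).union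
    ((continuous_hyperplaneReflection e t).measurable (measurableSet_lowerUnmatched hA))

lemma hyperplaneReflection_of_inner_eq {x : E} (h : inner ℝ e x = t) :
    hyperplaneReflection e t x = x := by
  simp [hyperplaneReflection, h]

/-- Points on the hyperplane itself are matched, so the three parts exhaust `A`. -/
lemma matched_union_unmatched (e : E) (t : ℝ) (A : Set E) :
    matched e t A ∪ upperUnmatched e t A ∪ lowerUnmatched e t A = A := by
  ext x
  simp only [matched, upperUnmatched, lowerUnmatched, Set.mem_union, Set.mem_inter_iff,
    Set.mem_preimage, Set.mem_compl_iff, Set.mem_ofPred_eq]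
  rcases lt_trichotomy (inner ℝ e x) t with h | h | h
  · have := h.not_gt; tauto
  · rw [hyperplaneReflection_of_inner_eq h]; tauto
  · have := h.not_gt; tauto

lemma disjoint_matched_upperUnmatched : Disjoint (matched e t A) (upperUnmatched e t A) :=
  Set.disjoint_left.2 fun _ h h' => h'.2.2 h.2

lemma disjoint_lowerUnmatched :
    Disjoint (matched e t A ∪ upperUnmatched e t A) (lowerUnmatched e t A) :=
  Set.disjoint_left.2 fun _ h h' =>
    h.elim (fun h => h'.2.2 h.2) fun h => lt_asymm (show t < _ from h.2.1) h'.2.1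

lemma disjoint_preimage_lowerUnmatched (he : ‖e‖ = 1) :
    Disjoint (matched e t A ∪ upperUnmatched e t A)
      (hyperplaneReflection e t ⁻¹' lowerUnmatched e t A) := by
  refine Set.disjoint_left.2 fun x h h' => h'.2.2 ?_
  rw [Set.mem_preimage, hyperplaneReflection_involutive he]
  exact h.elim (fun h => h.1) fun h => h.1

lemma preimage_matched (he : ‖e‖ = 1) :
    hyperplaneReflection e t ⁻¹' matched e t A = matched e t A := by
  ext x
  simp only [matched, Set.mem_preimage, Set.mem_inter_iff, (hyperplaneReflection_involutive he t) x]
  tauto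

lemma volume_eq_matched_add (hA : MeasurableSet A) :
    volume A = volume (matched e t A) + volume (upperUnmatched e t A) +
      volume (lowerUnmatched e t A) := by
  conv_lhs => rw [← matched_union_unmatched e t A]
  rw [measure_union disjoint_lowerUnmatched (measurableSet_lowerUnmatched hA),
    measure_union disjoint_matched_upperUnmatched (measurableSet_upperUnmatched hA)]

lemma volume_polarization (he : ‖e‖ = 1) (hA : MeasurableSet A) :
    volume (polarization e t A) = volume A := by
  have hm := measurableSet_lowerUnmatched (e := e) (t := t) hA
  rw [volume_eq_matched_add (e := e) (t := t) hA, polarization,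
    measure_union (disjoint_preimage_lowerUnmatched he)
      ((continuous_hyperplaneReflection e t).measurable hm),
    measure_union disjoint_matched_upperUnmatched (measurableSet_upperUnmatched hA),
    (measurePreserving_hyperplaneReflection he t).measure_preimage hm.nullMeasurableSet]

/-- For disjoint sets `S`, `U`, `L`, the energy of the union is the sum of the self energies, twice
the interactions with `S`, and twice the interaction of `U` and `L`. -/
lemma rieszEnergy_union_three (β : ℝ) {S U L : Set E} (hU : MeasurableSet U)
    (hL : MeasurableSet L) (hSU : Disjoint S U) (hSUL : Disjoint (S ∪ U) L) :
    rieszEnergy β (S ∪ U ∪ L) (S ∪ U ∪ L) =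
      (rieszEnergy β S S + rieszEnergy β U U + rieszEnergy β L L + 2 * rieszEnergy β S U +
        2 * rieszEnergy β S L) + 2 * rieszEnergy β U L := by
  rw [rieszEnergy_union_left β hL hSUL, rieszEnergy_union_left β hU hSU,
    rieszEnergy_union_right β hL hSUL, rieszEnergy_union_right β hU hSU,
    rieszEnergy_union_right β hL hSUL, rieszEnergy_union_right β hU hSU,
    rieszEnergy_union_right β hL hSUL, rieszEnergy_union_right β hU hSU,
    rieszEnergy_comm β U S, rieszEnergy_comm β L S, rieszEnergy_comm β L U]
  ring

lemma exists_rieszEnergy_polarization_eq (β : ℝ) (he : ‖e‖ = 1) (t : ℝ) (hA : MeasurableSet A) :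
    ∃ c, rieszEnergy β A A =
        c + 2 * rieszEnergy β (upperUnmatched e t A) (lowerUnmatched e t A) ∧
      rieszEnergy β (polarization e t A) (polarization e t A) =
        c + 2 * rieszEnergy β (upperUnmatched e t A)
          (hyperplaneReflection e t ⁻¹' lowerUnmatched e t A) := by
  have hS := measurableSet_matched (e := e) (t := t) hA
  have hU := measurableSet_upperUnmatched (e := e) (t := t) hA
  have hL := measurableSet_lowerUnmatched (e := e) (t := t) hA
  have hσ := measurePreserving_hyperplaneReflection he t
  have hiso := norm_hyperplaneReflection_sub he t
  refine ⟨rieszEnergy β (matched e t A) (matched e t A) +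
    rieszEnergy β (upperUnmatched e t A) (upperUnmatched e t A) +
    rieszEnergy β (lowerUnmatched e t A) (lowerUnmatched e t A) +
    2 * rieszEnergy β (matched e t A) (upperUnmatched e t A) +
    2 * rieszEnergy β (matched e t A) (lowerUnmatched e t A), ?_, ?_⟩
  · rw [← rieszEnergy_union_three β hU hL disjoint_matched_upperUnmatched
      disjoint_lowerUnmatched, matched_union_unmatched]
  · rw [← rieszEnergy_preimage β hσ hiso hL hL, ← rieszEnergy_preimage β hσ hiso hS hL,
      preimage_matched he, polarization, rieszEnergy_union_three β hU
      ((continuous_hyperplaneReflection e t).measurable hL)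
      disjoint_matched_upperUnmatched (disjoint_preimage_lowerUnmatched he)]

/-- Reflecting a point to the side of `x` brings it closer to `x`. -/
lemma norm_sub_hyperplaneReflection_lt (he : ‖e‖ = 1) {x y : E} (hx : t < inner ℝ e x)
    (hy : inner ℝ e y < t) : ‖x - hyperplaneReflection e t y‖ < ‖x - y‖ := by
  refine lt_of_pow_lt_pow_left₀ 2 (norm_nonneg _) ?_
  rw [norm_sub_hyperplaneReflection_sq he]
  nlinarith [mul_pos (sub_pos.2 hx) (sub_pos.2 hy)]

lemma setLIntegral_preimage_lowerUnmatched (β : ℝ) (he : ‖e‖ = 1) (hA : MeasurableSet A) (x : E) :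
    ∫⁻ y in hyperplaneReflection e t ⁻¹' lowerUnmatched e t A, ENNReal.ofReal (‖x - y‖ ^ β) =
      ∫⁻ y in lowerUnmatched e t A,
        ENNReal.ofReal (‖x - hyperplaneReflection e t y‖ ^ β) := by
  rw [← (measurePreserving_hyperplaneReflection he t).setLIntegral_comp_preimage
    (measurableSet_lowerUnmatched hA)
    (f := fun y => ENNReal.ofReal (‖x - hyperplaneReflection e t y‖ ^ β))
    ((measurable_rieszKernel_right β x).comp (continuous_hyperplaneReflection e t).measurable)]
  simp only [(hyperplaneReflection_involutive he t) _]

lemma setLIntegral_preimage_lowerUnmatched_le {β : ℝ} (hβ : 0 ≤ β) (he : ‖e‖ = 1)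
    (hA : MeasurableSet A) {x : E} (hx : t < inner ℝ e x) :
    ∫⁻ y in hyperplaneReflection e t ⁻¹' lowerUnmatched e t A, ENNReal.ofReal (‖x - y‖ ^ β) ≤
      ∫⁻ y in lowerUnmatched e t A, ENNReal.ofReal (‖x - y‖ ^ β) := by
  rw [setLIntegral_preimage_lowerUnmatched β he hA]
  refine setLIntegral_mono (measurable_rieszKernel_right β x) fun y hy => ?_
  exact ENNReal.ofReal_le_ofReal (Real.rpow_le_rpow (norm_nonneg _)
    (norm_sub_hyperplaneReflection_lt he hx hy.2.1).le hβ)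

lemma rieszEnergy_preimage_lowerUnmatched_le {β : ℝ} (hβ : 0 ≤ β) (he : ‖e‖ = 1) (t : ℝ)
    (hA : MeasurableSet A) :
    rieszEnergy β (upperUnmatched e t A) (hyperplaneReflection e t ⁻¹' lowerUnmatched e t A) ≤
      rieszEnergy β (upperUnmatched e t A) (lowerUnmatched e t A) :=
  setLIntegral_mono (measurable_rieszPotential β _) fun _ hx =>
    setLIntegral_preimage_lowerUnmatched_le hβ he hA hx.2.1

/-- Polarization does not increase the energy of an increasing kernel. -/
lemma rieszEnergy_polarization_le {β : ℝ} (hβ : 0 ≤ β) (he : ‖e‖ = 1) (t : ℝ)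
    (hA : MeasurableSet A) :
    rieszEnergy β (polarization e t A) (polarization e t A) ≤ rieszEnergy β A A := by
  obtain ⟨c, h1, h2⟩ := exists_rieszEnergy_polarization_eq β he t hA
  rw [h1, h2]
  gcongr
  exact rieszEnergy_preimage_lowerUnmatched_le hβ he t hA

/-- If polarization does not lower the (finite) energy of `A`, then all unmatched points of `A` lie
on one side of the hyperplane. -/
lemma volume_unmatched_eq_zero_of_le {β : ℝ} (hβ : 0 < β) (he : ‖e‖ = 1) (t : ℝ)
    (hA : MeasurableSet A) (hfin : rieszEnergy β A A ≠ ∞)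
    (hle : rieszEnergy β A A ≤ rieszEnergy β (polarization e t A) (polarization e t A)) :
    volume (upperUnmatched e t A) = 0 ∨ volume (lowerUnmatched e t A) = 0 := by
  have hU := measurableSet_upperUnmatched (e := e) (t := t) hA
  have hL := measurableSet_lowerUnmatched (e := e) (t := t) hA
  have hsub : upperUnmatched e t A ⊆ A := fun x hx => hx.1
  have hsub' : lowerUnmatched e t A ⊆ A := fun x hx => hx.1
  have hUL : rieszEnergy β (upperUnmatched e t A) (lowerUnmatched e t A) ≠ ∞ :=
    ne_top_of_le_ne_top hfin (rieszEnergy_mono β hsub hsub')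
  have hUL' := ne_top_of_le_ne_top hUL (rieszEnergy_preimage_lowerUnmatched_le hβ.le he t hA)
  obtain ⟨c, h1, h2⟩ := exists_rieszEnergy_polarization_eq β he t hA
  have hc : c ≠ ∞ := ne_top_of_le_ne_top hfin (h1 ▸ le_self_add)
  rw [h1, h2] at hle
  have hle' := (ENNReal.mul_le_mul_iff_right two_ne_zero ENNReal.ofNat_ne_top).1
    ((ENNReal.add_le_add_iff_left hc).1 hle)
  by_contra! hcon
  refine hle'.not_gt ?_
  refine setLIntegral_strict_mono hU hcon.1 (measurable_rieszPotential β _) hUL' ?_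
  have hae : ∀ᵐ x ∂volume.restrict (upperUnmatched e t A),
      ∫⁻ y in lowerUnmatched e t A, ENNReal.ofReal (‖x - y‖ ^ β) < ∞ :=
    ae_lt_top (measurable_rieszPotential β _) hUL
  rw [ae_restrict_iff' hU] at hae
  filter_upwards [hae] with x hx hxU
  rw [setLIntegral_preimage_lowerUnmatched β he hA]
  refine setLIntegral_strict_mono hL hcon.2 (measurable_rieszKernel_right β x)
    (ne_top_of_le_ne_top (hx hxU).ne ?_) (Filter.Eventually.of_forall fun y hy => ?_)
  · rw [← setLIntegral_preimage_lowerUnmatched β he hA]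
    exact setLIntegral_preimage_lowerUnmatched_le hβ.le he hA hxU.2.1
  · have h := norm_sub_hyperplaneReflection_lt he hxU.2.1 hy.2.1
    have h0 := (norm_nonneg _).trans_lt h
    exact (ENNReal.ofReal_lt_ofReal_iff (Real.rpow_pos_of_pos h0 β)).2
      (Real.rpow_lt_rpow (norm_nonneg _) h hβ)

end Polarization

end Energy

/-! ### Averaging over reflections -/

section Averaging

variable {E : Type*} [NormedAddCommGroup E] [InnerProductSpace ℝ E] [FiniteDimensional ℝ E]
  [MeasurableSpace E] [BorelSpace E]

/-- Integration in polar coordinates. -/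
lemma lintegral_eq_lintegral_sphere_Ioi [Nontrivial E] {f : E → ℝ≥0∞} (hf : Measurable f) :
    ∫⁻ x, f x = ∫⁻ θ : Metric.sphere (0 : E) 1, (∫⁻ r in Set.Ioi (0 : ℝ),
      ENNReal.ofReal (r ^ (Module.finrank ℝ E - 1)) * f (r • (θ : E))) ∂volume.toSphere := by
  have hf' : Measurable fun p : Metric.sphere (0 : E) 1 × Set.Ioi (0 : ℝ) =>
      f ((p.2 : ℝ) • (p.1 : E)) := by fun_prop
  calc ∫⁻ x, f x = ∫⁻ x : ({0}ᶜ : Set E), f x ∂((volume : Measure E).comap Subtype.val) := by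
        rw [lintegral_subtype_comap (measurableSet_singleton (0 : E)).compl,
          restrict_compl_singleton]
    _ = ∫⁻ p, f ((p.2 : ℝ) • (p.1 : E)) ∂((volume : Measure E).toSphere.prod
          (Measure.volumeIoiPow (Module.finrank ℝ E - 1))) := by
        rw [← (volume : Measure E).measurePreserving_homeomorphUnitSphereProd.lintegral_comp hf']
        refine lintegral_congr fun x => ?_
        congr 1
        have h := congrArg Subtype.val ((homeomorphUnitSphereProd E).symm_apply_apply x)
        rw [homeomorphUnitSphereProd_symm_apply_coe] at h
        exact h.symm
    _ = _ := by
        rw [lintegral_prod _ hf'.aemeasurable]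
        refine lintegral_congr fun θ => ?_
        rw [Measure.volumeIoiPow, lintegral_withDensity_eq_lintegral_mul _ (by fun_prop)
          (by fun_prop)]
        exact lintegral_subtype_comap measurableSet_Ioi
          (fun r : ℝ => ENNReal.ofReal (r ^ (Module.finrank ℝ E - 1)) * f (r • (θ : E)))

lemma lintegral_eq_two_mul_lintegral_comp {g : ℝ → ℝ≥0∞} (hg : Measurable g) (a : ℝ) :
    ∫⁻ r, g r = 2 * ∫⁻ t, g (2 * (t - a)) := by
  have h1 : ∫⁻ t, g (2 * (t - a)) = ∫⁻ t, g (2 * t) :=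
    lintegral_sub_right_eq_self (fun t => g (2 * t)) a
  have h2 := Real.smul_map_volume_mul_left (a := 2) two_ne_zero
  rw [h1]
  conv_lhs => rw [← h2]
  rw [lintegral_smul_measure, lintegral_map hg (by fun_prop)]
  simp

/-- The substitution `r = 2 (t - ⟪e, x⟫)` turns the ray from `x` in direction `e` into the family of
mirror images of `x`; only the hyperplanes with `-R ≤ t < 0` reflect `x` to a point of `N`. -/
lemma lintegral_indicator_ray_le {e x : E} (he : ‖e‖ = 1) {N : Set E} (hN : MeasurableSet N)
    {R : ℝ} (hx : ‖x‖ ≤ R) (hNR : ∀ y ∈ N, ‖y‖ ≤ R) (hlt : ∀ y ∈ N, ‖y‖ < ‖x‖) :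
    ∫⁻ r in Set.Ioi (0 : ℝ), N.indicator 1 (x + r • e) ≤
      2 * ∫⁻ t in Set.Ico (-R) 0, N.indicator (1 : E → ℝ≥0∞) (hyperplaneReflection e t x) := by
  have hmeas : Measurable fun r : ℝ => N.indicator (1 : E → ℝ≥0∞) (x + r • e) :=
    (measurable_one.indicator hN).comp (by fun_prop)
  rw [← lintegral_indicator measurableSet_Ioi, ← lintegral_indicator measurableSet_Ico,
    lintegral_eq_two_mul_lintegral_comp (hmeas.indicator measurableSet_Ioi) (inner ℝ e x)]
  gcongr with t
  by_cases hr : 0 < 2 * (t - inner ℝ e x)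
  swap
  · rw [Set.indicator_of_notMem (by simpa using hr)]; exact zero_le
  rw [Set.indicator_of_mem (Set.mem_Ioi.2 hr)]
  by_cases hy : hyperplaneReflection e t x ∈ N
  swap
  · rw [show x + (2 * (t - inner ℝ e x)) • e = hyperplaneReflection e t x from rfl,
      Set.indicator_of_notMem hy]; exact zero_le
  have hsq := norm_hyperplaneReflection_sq he t x
  have hlt' := pow_lt_pow_left₀ (hlt _ hy) (norm_nonneg _) two_ne_zero
  have h1 := abs_le.1 (abs_real_inner_le_norm e x)
  have h2 := abs_le.1 (abs_real_inner_le_norm e (hyperplaneReflection e t x))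
  rw [inner_hyperplaneReflection he] at h2
  rw [he, one_mul] at h1 h2
  have h3 := hNR _ hy
  rw [Set.indicator_of_mem (s := Set.Ico (-R) 0)]
  · rfl
  · exact ⟨by linarith, by nlinarith⟩

/-- If `P` lies further out than `N` and no reflection in a hyperplane off the origin maps more than
measure `K` of `P` into `N`, then `|P| |N|` is at most a constant times `K`. This is obtained by
integrating the overlap over all hyperplanes: as the hyperplane varies, the mirror image of `x ∈ P`
sweeps out `N`, in polar coordinates around `x`. -/
lemma volume_mul_volume_le_of_overlap_le [Nontrivial E] {P N : Set E} (hP : MeasurableSet P)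
    (hN : MeasurableSet N) {R : ℝ} (hPR : ∀ x ∈ P, ‖x‖ ≤ R) (hNR : ∀ y ∈ N, ‖y‖ ≤ R)
    (hlt : ∀ x ∈ P, ∀ y ∈ N, ‖y‖ < ‖x‖) {K : ℝ≥0∞}
    (hK : ∀ e : E, ‖e‖ = 1 → ∀ t < 0, volume (P ∩ hyperplaneReflection e t ⁻¹' N) ≤ K) :
    volume P * volume N ≤ ENNReal.ofReal ((2 * R) ^ (Module.finrank ℝ E - 1)) * 2 *
      (volume : Measure E).toSphere Set.univ * ENNReal.ofReal R * K := by
  set c := ENNReal.ofReal ((2 * R) ^ (Module.finrank ℝ E - 1))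
  have hind : Measurable (N.indicator (1 : E → ℝ≥0∞)) := measurable_one.indicator hN
  have hrefl : Measurable fun p : (E × Metric.sphere (0 : E) 1) × ℝ =>
      N.indicator (1 : E → ℝ≥0∞) (hyperplaneReflection p.1.2 p.2 p.1.1) := by
    refine hind.comp (Continuous.measurable ?_)
    unfold hyperplaneReflection
    fun_prop
  have hNx : ∀ x ∈ P, volume N ≤ c * 2 * ∫⁻ θ : Metric.sphere (0 : E) 1,
      (∫⁻ t in Set.Ico (-R) 0, N.indicator 1 (hyperplaneReflection (θ : E) t x))
        ∂volume.toSphere := by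
    intro x hx
    calc volume N = ∫⁻ z, N.indicator 1 (x + z) := by
          rw [lintegral_add_left_eq_self (fun z => N.indicator (1 : E → ℝ≥0∞) z),
            lintegral_indicator_one hN]
      _ = ∫⁻ θ : Metric.sphere (0 : E) 1, (∫⁻ r in Set.Ioi (0 : ℝ),
            ENNReal.ofReal (r ^ (Module.finrank ℝ E - 1)) *
              N.indicator 1 (x + r • (θ : E))) ∂volume.toSphere :=
          lintegral_eq_lintegral_sphere_Ioi (hind.comp (by fun_prop))
      _ ≤ ∫⁻ θ : Metric.sphere (0 : E) 1, c * (2 * ∫⁻ t in Set.Ico (-R) 0,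
            N.indicator 1 (hyperplaneReflection (θ : E) t x)) ∂volume.toSphere := by
          refine lintegral_mono fun θ => ?_
          have hθ : ‖(θ : E)‖ = 1 := by simp
          refine le_trans ?_ (mul_le_mul_right
            (lintegral_indicator_ray_le hθ hN (hPR x hx) hNR (hlt x hx)) c)
          rw [← lintegral_const_mul _ (f := fun r : ℝ => N.indicator (1 : E → ℝ≥0∞) (x + r • (θ : E)))
            (hind.comp (by fun_prop))]
          refine setLIntegral_mono' measurableSet_Ioi fun r hr => ?_
          by_cases hy : x + r • (θ : E) ∈ N
          · gcongr
            -- two points of the ball of radius `R` have distance `r ≤ 2 R`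
            refine ENNReal.ofReal_le_ofReal (pow_le_pow_left₀ (le_of_lt hr) ?_ _)
            have h1 : ‖r • (θ : E)‖ ≤ ‖x + r • (θ : E)‖ + ‖x‖ := by
              simpa using norm_sub_le (x + r • (θ : E)) x
            rw [norm_smul, hθ, mul_one, Real.norm_of_nonneg (le_of_lt hr)] at h1
            linarith [hPR x hx, hNR _ hy]
          · simp [hy]
      _ = _ := by
          rw [← lintegral_const_mul]
          · simp_rw [mul_assoc]
          · exact (hrefl.comp (by fun_prop :
              Measurable fun p : Metric.sphere (0 : E) 1 × ℝ => ((x, p.1), p.2))).lintegral_prod_right'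
  have hin : Measurable fun p : E × Metric.sphere (0 : E) 1 =>
      ∫⁻ t in Set.Ico (-R) 0, N.indicator (1 : E → ℝ≥0∞) (hyperplaneReflection (p.2 : E) t p.1) :=
    hrefl.lintegral_prod_right'
  calc volume P * volume N = ∫⁻ x in P, volume N := by
        rw [setLIntegral_const, mul_comm]
    _ ≤ ∫⁻ x in P, c * 2 * ∫⁻ θ : Metric.sphere (0 : E) 1,
          (∫⁻ t in Set.Ico (-R) 0, N.indicator 1 (hyperplaneReflection (θ : E) t x))
            ∂volume.toSphere := setLIntegral_mono' hP hNx
    _ = c * 2 * ∫⁻ θ : Metric.sphere (0 : E) 1, (∫⁻ t in Set.Ico (-R) 0,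
          (∫⁻ x in P, N.indicator 1 (hyperplaneReflection (θ : E) t x))) ∂volume.toSphere := by
        rw [lintegral_const_mul _ hin.lintegral_prod_right',
          lintegral_lintegral_swap hin.aemeasurable]
        congr 1
        refine lintegral_congr fun θ => lintegral_lintegral_swap ?_
        exact (hrefl.comp (by fun_prop :
          Measurable fun p : E × ℝ => ((p.1, θ), p.2))).aemeasurable
    _ ≤ c * 2 * ∫⁻ θ : Metric.sphere (0 : E) 1, (∫⁻ t in Set.Ico (-R) 0, K)
          ∂volume.toSphere := by
        refine mul_le_mul_right (lintegral_mono fun θ =>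
          setLIntegral_mono' measurableSet_Ico fun t ht => ?_) _
        have hθ : ‖(θ : E)‖ = 1 := by simp
        have hm := (continuous_hyperplaneReflection (θ : E) t).measurable hN
        refine le_trans (le_of_eq ?_) (hK θ hθ t ht.2)
        rw [Set.inter_comm, ← Measure.restrict_apply hm, ← lintegral_indicator_one hm]
        rfl
    _ = _ := by
        rw [setLIntegral_const, lintegral_const, Real.volume_Ico]
        simp only [sub_neg_eq_add, zero_add]
        ring

end Averaging

/-! ### Riesz's inequality for bounded sets -/

section BoundedSets

variable {E : Type*} [NormedAddCommGroup E] [InnerProductSpace ℝ E] [FiniteDimensional ℝ E]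
  [MeasurableSpace E] [BorelSpace E]

lemma norm_hyperplaneReflection_lt_iff {e : E} (he : ‖e‖ = 1) {t : ℝ} (ht : t < 0) {x : E} :
    ‖hyperplaneReflection e t x‖ < ‖x‖ ↔ inner ℝ e x < t := by
  rw [← pow_lt_pow_iff_left₀ (norm_nonneg _) (norm_nonneg _) two_ne_zero,
    norm_hyperplaneReflection_sq he]
  constructor <;> intro h <;> nlinarith

lemma polarization_subset_closedBall {e : E} (he : ‖e‖ = 1) {t : ℝ} (ht : t < 0) {A : Set E}
    {R : ℝ} (hA : A ⊆ Metric.closedBall 0 R) : polarization e t A ⊆ Metric.closedBall 0 R := by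
  rintro x ((hx | hx) | hx)
  · exact hA hx.1
  · exact hA hx.1
  · have h1 := mem_closedBall_zero_iff.1 (hA hx.1)
    have h2 := (norm_hyperplaneReflection_lt_iff he ht).2 hx.2.1
    rw [hyperplaneReflection_involutive he] at h2
    exact mem_closedBall_zero_iff.2 (h2.le.trans h1)

/-- Polarization towards a half-space containing the origin increases the overlap with a centred
ball, by at least the measure of the part of `A \ B` that is reflected into `B \ A`. -/
lemma volume_inter_closedBall_add_le_polarization {e : E} (he : ‖e‖ = 1) {t : ℝ} (ht : t < 0)
    {A : Set E} (hA : MeasurableSet A) (r : ℝ) :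
    volume (A ∩ Metric.closedBall 0 r) + volume ((A \ Metric.closedBall 0 r) ∩
        hyperplaneReflection e t ⁻¹' (Metric.closedBall 0 r \ A)) ≤
      volume (polarization e t A ∩ Metric.closedBall 0 r) := by
  set B : Set E := Metric.closedBall 0 r
  have hB : MeasurableSet B := Metric.isClosed_closedBall.measurableSet
  set Q := (A \ B) ∩ hyperplaneReflection e t ⁻¹' (B \ A)
  have hσ := continuous_hyperplaneReflection e t
  have hinv := hyperplaneReflection_involutive he t
  have hQ : MeasurableSet Q := (hA.diff hB).inter (hσ.measurable (hB.diff hA))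
  have hL := measurableSet_lowerUnmatched (e := e) (t := t) hA
  have hQL : Q ⊆ lowerUnmatched e t A := by
    intro x hx
    refine ⟨hx.1.1, (norm_hyperplaneReflection_lt_iff he ht).1 ?_, hx.2.2⟩
    have h1 := mem_closedBall_zero_iff.1 hx.2.1
    have h2 : ¬ ‖x‖ ≤ r := fun h => hx.1.2 (mem_closedBall_zero_iff.2 h)
    exact h1.trans_lt (not_le.1 h2)
  have hW : MeasurableSet (lowerUnmatched e t A ∩ B ∪ Q) := (hL.inter hB).union hQ
  calc volume (A ∩ B) + volume Q
      = volume ((matched e t A ∪ upperUnmatched e t A) ∩ B) +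
          volume (lowerUnmatched e t A ∩ B ∪ Q) := by
        conv_lhs => rw [← matched_union_unmatched e t A]
        rw [Set.union_inter_distrib_right, measure_union _ (hL.inter hB), add_assoc,
          measure_union _ hQ]
        · exact Set.disjoint_left.2 fun x hx hx' => hx'.1.2 hx.2
        · exact disjoint_lowerUnmatched.mono Set.inter_subset_left Set.inter_subset_left
    _ = volume ((matched e t A ∪ upperUnmatched e t A) ∩ B ∪
          hyperplaneReflection e t ⁻¹' (lowerUnmatched e t A ∩ B ∪ Q)) := by
        rw [measure_union _ (hσ.measurable hW),
          (measurePreserving_hyperplaneReflection he t).measure_preimage hW.nullMeasurableSet]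
        refine (disjoint_preimage_lowerUnmatched he).mono Set.inter_subset_left
          (Set.preimage_mono (Set.union_subset Set.inter_subset_left hQL))
    _ ≤ volume (polarization e t A ∩ B) := by
        refine measure_mono ?_
        rintro x (hx | hx | hx)
        · exact ⟨Or.inl hx.1, hx.2⟩
        · refine ⟨Or.inr hx.1, mem_closedBall_zero_iff.2 ?_⟩
          have h1 := mem_closedBall_zero_iff.1 hx.2
          have h2 := (norm_hyperplaneReflection_lt_iff he ht).2 hx.1.2.1
          rw [hinv] at h2
          exact h2.le.trans h1
        · have h := hx.2.1
          rw [hinv] at h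
          exact ⟨Or.inr (hQL hx), h⟩

lemma volume_real_sdiff_eq_of_volume_eq {A B : Set E} (hA : MeasurableSet A)
    (hB : MeasurableSet B) (hBfin : volume B ≠ ∞) (h : volume A = volume B) :
    volume.real (A \ B) = volume.real B - volume.real (A ∩ B) ∧
      volume.real (B \ A) = volume.real B - volume.real (A ∩ B) := by
  have h1 := measureReal_inter_add_sdiff (s := A) hB (h ▸ hBfin)
  have h2 := measureReal_inter_add_sdiff (s := B) hA hBfin
  have h3 : volume.real A = volume.real B := by rw [measureReal_def, h, measureReal_def]
  rw [Set.inter_comm] at h2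
  constructor <;> linarith

/-- Among the sets in a fixed ball with the volume of `A` and at most its energy, there are sets
that fill the centred ball `B` of the same volume up to an arbitrarily small error: otherwise a
polarization would increase the supremum of the possible overlaps. -/
lemma exists_rieszEnergy_le_volume_sdiff_le [Nontrivial E] {β : ℝ} (hβ : 0 ≤ β) {A : Set E}
    (hA : MeasurableSet A) {R r : ℝ} (hAR : A ⊆ Metric.closedBall 0 R)
    (hvol : volume A = volume (Metric.closedBall (0 : E) r)) {ε : ℝ} (hε : 0 < ε) :
    ∃ F : Set E, MeasurableSet F ∧ rieszEnergy β F F ≤ rieszEnergy β A A ∧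
      volume.real (Metric.closedBall 0 r \ F) ≤ ε := by
  set B : Set E := Metric.closedBall 0 r
  have hB : MeasurableSet B := Metric.isClosed_closedBall.measurableSet
  have hBfin : volume B ≠ ∞ := measure_closedBall_lt_top.ne
  set C : ℝ≥0∞ := ENNReal.ofReal ((2 * max R r) ^ (Module.finrank ℝ E - 1)) * 2 *
      (volume : Measure E).toSphere Set.univ * ENNReal.ofReal (max R r)
  have hC : C ≠ ∞ := by
    refine ENNReal.mul_ne_top (ENNReal.mul_ne_top (ENNReal.mul_ne_top ?_ ?_) ?_) ?_ <;>
      simp [ENNReal.mul_ne_top, measure_ball_lt_top.ne]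
  let cls : Set (Set E) := {F | MeasurableSet F ∧ F ⊆ Metric.closedBall 0 R ∧
    volume F = volume B ∧ rieszEnergy β F F ≤ rieszEnergy β A A}
  let v : Set E → ℝ := fun F => volume.real (F ∩ B)
  have hbdd : BddAbove (v '' cls) :=
    ⟨volume.real B, by
      rintro _ ⟨F, -, rfl⟩
      exact measureReal_mono Set.inter_subset_right hBfin⟩
  have hne : (v '' cls).Nonempty := ⟨_, A, ⟨hA, hAR, hvol, le_rfl⟩, rfl⟩
  set c : ℝ := 1 / (C.toReal + 1)
  have hc : 0 < c := by positivity
  -- Averaging yields a polarization whose gain in overlap is at least `c` times the square of the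
  -- defect `|B \ F|`, where `c C < 1` for the constant `C` of the averaging estimate.
  have himp : ∀ F ∈ cls, ∃ F' ∈ cls,
      v F + c * (volume.real B - v F) ^ 2 ≤ v F' := by
    rintro F ⟨hF, hFR, hFvol, hFE⟩
    obtain ⟨h1, h2⟩ := volume_real_sdiff_eq_of_volume_eq hF hB hBfin hFvol
    have hFfin : volume F ≠ ∞ := hFvol ▸ hBfin
    set δ := volume.real B - v F with hδ
    have hδ0 : 0 ≤ δ := h1 ▸ measureReal_nonneg
    rcases hδ0.eq_or_lt with h0 | h0
    · exact ⟨F, ⟨hF, hFR, hFvol, hFE⟩, by rw [← h0]; simp⟩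
    have hex : ∃ e : E, ‖e‖ = 1 ∧ ∃ t < 0, ENNReal.ofReal (c * δ ^ 2) <
        volume ((F \ B) ∩ hyperplaneReflection e t ⁻¹' (B \ F)) := by
      by_contra! hcon
      have h := volume_mul_volume_le_of_overlap_le (R := max R r) (hF.diff hB) (hB.diff hF)
        (fun x hx => (mem_closedBall_zero_iff.1 (hFR hx.1)).trans (le_max_left _ _))
        (fun x hx => (mem_closedBall_zero_iff.1 hx.1).trans (le_max_right _ _))
        (fun x hx y hy => (mem_closedBall_zero_iff.1 hy.1).trans_lt
          (not_le.1 fun h => hx.2 (mem_closedBall_zero_iff.2 h))) hcon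
      have h' := ENNReal.toReal_mono (ENNReal.mul_ne_top hC ENNReal.ofReal_ne_top) h
      rw [ENNReal.toReal_mul, ENNReal.toReal_mul, ENNReal.toReal_ofReal (by positivity),
        ← measureReal_def, ← measureReal_def, h1, h2] at h'
      have h3 : C.toReal * (c * δ ^ 2) < δ * δ := by
        have : C.toReal * c < 1 := by
          rw [mul_one_div, div_lt_one (by positivity)]; linarith
        nlinarith [mul_pos h0 h0]
      exact absurd h' (not_le.2 h3)
    obtain ⟨e, he, t, ht, hlt⟩ := hex
    refine ⟨polarization e t F, ⟨measurableSet_polarization hF,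
      polarization_subset_closedBall he ht hFR, (volume_polarization he hF).trans hFvol,
      (rieszEnergy_polarization_le hβ he t hF).trans hFE⟩, ?_⟩
    have h := volume_inter_closedBall_add_le_polarization he ht hF r
    have h' := (add_le_add_right hlt.le (volume (F ∩ B))).trans h
    have h4 : volume (F ∩ B) ≠ ∞ := measure_ne_top_of_subset Set.inter_subset_right hBfin
    have h5 : volume (polarization e t F ∩ B) ≠ ∞ :=
      measure_ne_top_of_subset Set.inter_subset_right hBfin
    have h6 := ENNReal.toReal_mono h5 h'
    rw [ENNReal.toReal_add h4 ENNReal.ofReal_ne_top, ENNReal.toReal_ofReal (by positivity)] at h6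
    exact h6
  by_contra! hcon
  have hgap : ∀ F ∈ cls, ε < volume.real B - v F := by
    rintro F ⟨hF, hFR, hFvol, hFE⟩
    rw [← (volume_real_sdiff_eq_of_volume_eq hF hB hBfin hFvol).2]
    exact hcon F hF hFE
  obtain ⟨_, ⟨F, hF, rfl⟩, hFs⟩ := exists_lt_of_lt_csSup hne
    (sub_lt_self (sSup (v '' cls)) (mul_pos hc (pow_pos hε 2)))
  obtain ⟨F', hF', hle⟩ := himp F hF
  have h1 := le_csSup hbdd ⟨F', hF', rfl⟩
  have h2 : c * ε ^ 2 ≤ c * (volume.real B - v F) ^ 2 := by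
    gcongr
    exact (hgap F hF).le
  linarith

/-- The energy of a ball exceeds that of `F` by at most a multiple of the part of the ball not
covered by `F`. -/
lemma rieszEnergy_closedBall_le_add {β : ℝ} (hβ : 0 ≤ β) {F : Set E} (hF : MeasurableSet F)
    (r : ℝ) :
    rieszEnergy β (Metric.closedBall (0 : E) r) (Metric.closedBall 0 r) ≤ rieszEnergy β F F +
      2 * (ENNReal.ofReal ((2 * r) ^ β) * volume (Metric.closedBall (0 : E) r)) *
        volume (Metric.closedBall 0 r \ F) := by
  set B : Set E := Metric.closedBall 0 r
  have hB : MeasurableSet B := Metric.isClosed_closedBall.measurableSet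
  have hBF : B ∩ F ∪ B \ F = B := Set.inter_union_sdiff B F
  have hdisj : Disjoint (B ∩ F) (B \ F) := Set.disjoint_sdiff_inter.symm
  have hsmall : rieszEnergy β (B \ F) B ≤
      ENNReal.ofReal ((2 * r) ^ β) * volume B * volume (B \ F) := by
    rw [← setLIntegral_const]
    refine setLIntegral_mono' (hB.diff hF) fun x hx => ?_
    rw [← setLIntegral_const]
    refine setLIntegral_mono' hB fun y hy => ENNReal.ofReal_le_ofReal ?_
    refine Real.rpow_le_rpow (norm_nonneg _) ((norm_sub_le _ _).trans ?_) hβ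
    linarith [mem_closedBall_zero_iff.1 hx.1, mem_closedBall_zero_iff.1 hy]
  calc rieszEnergy β B B
      = rieszEnergy β (B ∩ F) (B ∩ F) + rieszEnergy β (B ∩ F) (B \ F) +
          rieszEnergy β (B \ F) B := by
        conv_lhs => rw [← hBF]
        rw [rieszEnergy_union_left β (hB.diff hF) hdisj,
          rieszEnergy_union_right β (hB.diff hF) hdisj, hBF]
    _ ≤ rieszEnergy β F F + rieszEnergy β (B \ F) B + rieszEnergy β (B \ F) B := by
        gcongr
        · exact rieszEnergy_mono β Set.inter_subset_right Set.inter_subset_right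
        · rw [rieszEnergy_comm]
          exact rieszEnergy_mono β le_rfl Set.inter_subset_left
    _ ≤ _ := by
        rw [add_assoc, ← two_mul, mul_assoc]
        gcongr

/-- A centred ball minimizes the energy among bounded sets of the same volume. -/
lemma rieszEnergy_closedBall_le_of_subset [Nontrivial E] {β : ℝ} (hβ : 0 ≤ β) {A : Set E}
    (hA : MeasurableSet A) {R r : ℝ} (hAR : A ⊆ Metric.closedBall 0 R)
    (hvol : volume A = volume (Metric.closedBall (0 : E) r)) :
    rieszEnergy β (Metric.closedBall (0 : E) r) (Metric.closedBall 0 r) ≤ rieszEnergy β A A := by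
  set M := 2 * (ENNReal.ofReal ((2 * r) ^ β) * volume (Metric.closedBall (0 : E) r))
  have hM : M ≠ ∞ := ENNReal.mul_ne_top (by simp)
    (ENNReal.mul_ne_top ENNReal.ofReal_ne_top measure_closedBall_lt_top.ne)
  refine ENNReal.le_of_forall_pos_le_add fun ε hε _ => ?_
  obtain ⟨F, hF, hFE, hFvol⟩ := exists_rieszEnergy_le_volume_sdiff_le hβ hA hAR hvol
    (ε := ε / (M.toReal + 1)) (by positivity)
  refine (rieszEnergy_closedBall_le_add hβ hF r).trans (add_le_add hFE ?_)
  have hfin : volume (Metric.closedBall 0 r \ F) ≠ ∞ :=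
    measure_ne_top_of_subset Set.sdiff_subset measure_closedBall_lt_top.ne
  rw [← ENNReal.ofReal_coe_nnreal, ENNReal.le_ofReal_iff_toReal_le (ENNReal.mul_ne_top hM hfin)
    ε.coe_nonneg, ENNReal.toReal_mul]
  calc M.toReal * volume.real (Metric.closedBall 0 r \ F)
      ≤ M.toReal * (ε / (M.toReal + 1)) := by gcongr
    _ ≤ (M.toReal + 1) * (ε / (M.toReal + 1)) := by gcongr; linarith
    _ = ε := by field_simp

end BoundedSets

/-! ### Moments of the unit ball -/

section GaussianMoments

variable {E : Type*} [NormedAddCommGroup E] [InnerProductSpace ℝ E] [FiniteDimensional ℝ E]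
  [MeasurableSpace E] [BorelSpace E]

lemma exists_orthonormalBasis_apply_eq {θ : E} (hθ : ‖θ‖ = 1) :
    ∃ (b : OrthonormalBasis (Fin (Module.finrank ℝ E)) ℝ E) (i : Fin (Module.finrank ℝ E)),
      b i = θ := by
  have : Nontrivial E := ⟨θ, 0, by rintro rfl; simp at hθ⟩
  let i₀ : Fin (Module.finrank ℝ E) := ⟨0, Module.finrank_pos⟩
  obtain ⟨b, hb⟩ := Orthonormal.exists_orthonormalBasis_extension_of_card_eq (𝕜 := ℝ) (E := E)
    (ι := Fin (Module.finrank ℝ E)) (by simp) (v := fun _ => θ) (s := {i₀})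
    ⟨fun _ => hθ, fun i j hij => absurd (Subsingleton.elim i j) hij⟩
  exact ⟨b, i₀, hb i₀ rfl⟩

lemma integral_abs_rpow_mul_exp_neg_sq {α : ℝ} (hα : 0 < α) :
    ∫ x : ℝ, |x| ^ α * Real.exp (-x ^ 2) = Real.Gamma ((α + 1) / 2) := by
  have h := integral_comp_abs (f := fun x : ℝ => x ^ α * Real.exp (-x ^ (2 : ℝ)))
  rw [integral_rpow_mul_exp_neg_rpow two_pos (by linarith)] at h
  simp only [Real.rpow_two, sq_abs] at h
  rw [h]; ring

/-- The absolute moments of the marginals of the Gaussian weight `exp (-|x|²)`. -/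
lemma integral_abs_inner_rpow_mul_exp_neg_norm_sq {α : ℝ} (hα : 0 < α) {θ : E} (hθ : ‖θ‖ = 1) :
    ∫ x : E, |inner ℝ θ x| ^ α * Real.exp (-‖x‖ ^ 2) =
      Real.pi ^ (((Module.finrank ℝ E : ℝ) - 1) / 2) * Real.Gamma ((α + 1) / 2) := by
  obtain ⟨b, i₀, hb⟩ := exists_orthonormalBasis_apply_eq hθ
  have hn : 0 < Module.finrank ℝ E := i₀.pos
  rw [← (b.measurePreserving_repr_symm).integral_comp
    b.repr.symm.toHomeomorph.measurableEmbedding,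
    ← (PiLp.volume_preserving_toLp (Fin (Module.finrank ℝ E))).integral_comp
    (MeasurableEquiv.toLp 2 (Fin (Module.finrank ℝ E) → ℝ)).measurableEmbedding]
  have hprod : ∀ v : Fin (Module.finrank ℝ E) → ℝ,
      |inner ℝ θ (b.repr.symm (WithLp.toLp 2 v))| ^ α *
        Real.exp (-‖b.repr.symm (WithLp.toLp 2 v)‖ ^ 2) =
      ∏ i, ((if i = i₀ then |v i| ^ α else 1) * Real.exp (-(v i) ^ 2)) := by
    intro v
    have h1 : inner ℝ θ (b.repr.symm (WithLp.toLp 2 v)) = v i₀ := by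
      rw [← hb, ← b.repr_apply_apply, LinearIsometryEquiv.apply_symm_apply]
    rw [h1, LinearIsometryEquiv.norm_map, EuclideanSpace.norm_sq_eq, ← Finset.sum_neg_distrib,
      Real.exp_sum, Finset.prod_mul_distrib, Finset.prod_ite_eq' Finset.univ i₀]
    simp
  simp_rw [hprod]
  rw [integral_fintype_prod_volume_eq_prod
    (fun (i : Fin (Module.finrank ℝ E)) (x : ℝ) =>
      (if i = i₀ then |x| ^ α else 1) * Real.exp (-x ^ 2)),
    ← Finset.mul_prod_erase _ _ (Finset.mem_univ i₀)]
  have h2 : ∀ i ∈ Finset.univ.erase i₀,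
      ∫ x : ℝ, (if i = i₀ then |x| ^ α else 1) * Real.exp (-x ^ 2) = √Real.pi := by
    intro i hi
    simp only [(Finset.mem_erase.1 hi).1, if_false, one_mul]
    simpa using integral_gaussian 1
  rw [Finset.prod_congr rfl h2]
  simp only [if_true, Finset.prod_const, Finset.card_erase_of_mem (Finset.mem_univ i₀),
    Finset.card_univ, Fintype.card_fin]
  rw [integral_abs_rpow_mul_exp_neg_sq hα, mul_comm, Real.sqrt_eq_rpow, ← Real.rpow_natCast,
    ← Real.rpow_mul Real.pi_pos.le, Nat.cast_sub hn]
  congr 2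
  push_cast
  ring

lemma lintegral_abs_inner_rpow_mul_exp_neg_norm_sq {α : ℝ} (hα : 0 < α) {θ : E} (hθ : ‖θ‖ = 1) :
    ∫⁻ x : E, ENNReal.ofReal (|inner ℝ θ x| ^ α) * ENNReal.ofReal (Real.exp (-‖x‖ ^ 2)) =
      ENNReal.ofReal (Real.pi ^ (((Module.finrank ℝ E : ℝ) - 1) / 2) *
        Real.Gamma ((α + 1) / 2)) := by
  have h := integral_abs_inner_rpow_mul_exp_neg_norm_sq hα hθ
  have hpos : 0 < Real.pi ^ (((Module.finrank ℝ E : ℝ) - 1) / 2) * Real.Gamma ((α + 1) / 2) :=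
    mul_pos (Real.rpow_pos_of_pos Real.pi_pos _) (Real.Gamma_pos_of_pos (by linarith))
  -- the integral is nonzero, so the integrand is integrable
  have hint : Integrable fun x : E => |inner ℝ θ x| ^ α * Real.exp (-‖x‖ ^ 2) :=
    not_imp_comm.1 integral_undef (h ▸ hpos.ne')
  rw [← h, ofReal_integral_eq_lintegral_ofReal hint
    (Filter.Eventually.of_forall fun x => by positivity)]
  refine lintegral_congr fun x => ?_
  rw [ENNReal.ofReal_mul (by positivity)]

/-- Scaling of the moments of balls centred at the origin. -/
lemma setLIntegral_closedBall_abs_inner_rpow {α : ℝ} (θ : E) {r : ℝ} (hr : 0 < r) :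
    ∫⁻ x in Metric.closedBall (0 : E) r, ENNReal.ofReal (|inner ℝ θ x| ^ α) =
      ENNReal.ofReal (r ^ (Module.finrank ℝ E + α)) *
        ∫⁻ x in Metric.closedBall (0 : E) 1, ENNReal.ofReal (|inner ℝ θ x| ^ α) := by
  have hmeas : ∀ s : ℝ, Measurable ((Metric.closedBall (0 : E) s).indicator
      fun x : E => ENNReal.ofReal (|inner ℝ θ x| ^ α)) := fun s =>
    Measurable.indicator (by fun_prop) Metric.isClosed_closedBall.measurableSet
  have hscale : ∀ x : E, (Metric.closedBall (0 : E) r).indicator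
      (fun x : E => ENNReal.ofReal (|inner ℝ θ x| ^ α)) (r • x) =
      ENNReal.ofReal (r ^ α) * (Metric.closedBall (0 : E) 1).indicator
        (fun x : E => ENNReal.ofReal (|inner ℝ θ x| ^ α)) x := by
    intro x
    by_cases hx : ‖x‖ ≤ 1
    · rw [Set.indicator_of_mem, Set.indicator_of_mem (mem_closedBall_zero_iff.2 hx),
        inner_smul_right, abs_mul, abs_of_pos hr, Real.mul_rpow hr.le (abs_nonneg _),
        ENNReal.ofReal_mul (by positivity)]
      rw [mem_closedBall_zero_iff, norm_smul, Real.norm_of_nonneg hr.le]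
      nlinarith
    · rw [Set.indicator_of_notMem, Set.indicator_of_notMem (by simpa using hx), mul_zero]
      rw [mem_closedBall_zero_iff, norm_smul, Real.norm_of_nonneg hr.le]
      nlinarith
  have hrn : (0 : ℝ) < r ^ Module.finrank ℝ E := by positivity
  have h := lintegral_map (μ := (volume : Measure E)) (hmeas r) (measurable_const_smul r)
  rw [Measure.map_addHaar_smul _ hr.ne', lintegral_smul_measure] at h
  simp_rw [hscale] at h
  rw [lintegral_const_mul _ (hmeas 1), lintegral_indicator Metric.isClosed_closedBall.measurableSet,
    lintegral_indicator Metric.isClosed_closedBall.measurableSet, abs_of_pos (inv_pos.2 hrn),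
    smul_eq_mul] at h
  calc _ = ENNReal.ofReal (r ^ Module.finrank ℝ E) *
        (ENNReal.ofReal (r ^ Module.finrank ℝ E)⁻¹ *
          ∫⁻ x in Metric.closedBall (0 : E) r, ENNReal.ofReal (|inner ℝ θ x| ^ α)) := by
        rw [← mul_assoc, ← ENNReal.ofReal_mul hrn.le, mul_inv_cancel₀ hrn.ne', ENNReal.ofReal_one,
          one_mul]
    _ = _ := by
        rw [h, ← mul_assoc, ← ENNReal.ofReal_mul hrn.le, Real.rpow_add hr, Real.rpow_natCast]

lemma ofReal_exp_neg_eq_lintegral {a : ℝ} :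
    ENNReal.ofReal (Real.exp (-a)) = ∫⁻ s in Set.Ici a, ENNReal.ofReal (Real.exp (-s)) := by
  rw [setLIntegral_congr Ioi_ae_eq_Ici.symm, ← ofReal_integral_eq_lintegral_ofReal
    (integrableOn_exp_neg_Ioi a) (Filter.Eventually.of_forall fun _ => (Real.exp_pos _).le),
    integral_exp_neg_Ioi]

/-- The Gaussian integral of a homogeneous function is a Gamma factor times its integral over the
unit ball: write `exp (-|x|²)` as an integral of indicators of balls. -/
lemma lintegral_gaussian_eq_Gamma_mul {α : ℝ} (hα : 0 < α) (θ : E) :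
    ∫⁻ x : E, ENNReal.ofReal (|inner ℝ θ x| ^ α) * ENNReal.ofReal (Real.exp (-‖x‖ ^ 2)) =
      ENNReal.ofReal (Real.Gamma ((Module.finrank ℝ E + α) / 2 + 1)) *
        ∫⁻ x in Metric.closedBall (0 : E) 1, ENNReal.ofReal (|inner ℝ θ x| ^ α) := by
  set p : ℝ := Module.finrank ℝ E + α
  have hp : 0 < p := by positivity
  set F : E → ℝ → ℝ≥0∞ := fun x s => {q : E × ℝ | ‖q.1‖ ^ 2 ≤ q.2}.indicator
    (fun q => ENNReal.ofReal (|inner ℝ θ q.1| ^ α) * ENNReal.ofReal (Real.exp (-q.2))) (x, s)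
  have hF1 : ∀ x s, ‖x‖ ^ 2 ≤ s →
      F x s = ENNReal.ofReal (|inner ℝ θ x| ^ α) * ENNReal.ofReal (Real.exp (-s)) :=
    fun x s hxs => Set.indicator_of_mem (s := {q : E × ℝ | ‖q.1‖ ^ 2 ≤ q.2}) hxs _
  have hF0 : ∀ x s, ¬ ‖x‖ ^ 2 ≤ s → F x s = 0 :=
    fun x s hxs => Set.indicator_of_notMem (s := {q : E × ℝ | ‖q.1‖ ^ 2 ≤ q.2}) hxs _
  have hFmeas : Measurable (Function.uncurry F) := by
    refine Measurable.indicator (by fun_prop) ?_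
    exact measurableSet_le (by fun_prop) (by fun_prop)
  have h1 : ∀ x : E, ENNReal.ofReal (|inner ℝ θ x| ^ α) * ENNReal.ofReal (Real.exp (-‖x‖ ^ 2)) =
      ∫⁻ s in Set.Ioi (0 : ℝ), F x s := by
    intro x
    rw [ofReal_exp_neg_eq_lintegral, ← lintegral_const_mul _ (by fun_prop),
      ← lintegral_indicator measurableSet_Ici, setLIntegral_congr Ioi_ae_eq_Ici,
      ← lintegral_indicator measurableSet_Ici]
    refine lintegral_congr fun s => ?_
    by_cases hs : ‖x‖ ^ 2 ≤ s
    · rw [Set.indicator_of_mem (Set.mem_Ici.2 hs),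
        Set.indicator_of_mem (Set.mem_Ici.2 ((sq_nonneg _).trans hs))]
      exact (hF1 x s hs).symm
    · rw [Set.indicator_of_notMem (by simpa using hs)]
      simp [Set.indicator_apply, hF0 x s hs]
  have h2 : ∀ s ∈ Set.Ioi (0 : ℝ), ∫⁻ x, F x s =
      ENNReal.ofReal (Real.exp (-s) * s ^ (p / 2 + 1 - 1)) *
        ∫⁻ x in Metric.closedBall (0 : E) 1, ENNReal.ofReal (|inner ℝ θ x| ^ α) := by
    intro s hs
    have hs' : (0 : ℝ) < s := hs
    have h3 : ∀ x, F x s = ENNReal.ofReal (Real.exp (-s)) *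
        (Metric.closedBall (0 : E) (√s)).indicator
          (fun x => ENNReal.ofReal (|inner ℝ θ x| ^ α)) x := by
      intro x
      by_cases hx : ‖x‖ ^ 2 ≤ s
      · rw [Set.indicator_of_mem (mem_closedBall_zero_iff.2 (Real.le_sqrt_of_sq_le hx)), mul_comm]
        exact hF1 x s hx
      · rw [Set.indicator_of_notMem, mul_zero]
        · exact hF0 x s hx
        · rw [mem_closedBall_zero_iff, Real.le_sqrt (norm_nonneg _) hs'.le]
          exact hx
    simp_rw [h3]
    rw [lintegral_const_mul _ (Measurable.indicator (by fun_prop)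
        Metric.isClosed_closedBall.measurableSet),
      lintegral_indicator Metric.isClosed_closedBall.measurableSet,
      setLIntegral_closedBall_abs_inner_rpow θ (Real.sqrt_pos.2 hs'), ← mul_assoc,
      ← ENNReal.ofReal_mul (Real.exp_pos _).le, Real.sqrt_eq_rpow, ← Real.rpow_mul hs'.le]
    congr 4
    ring
  simp_rw [h1]
  rw [lintegral_lintegral_swap hFmeas.aemeasurable, setLIntegral_congr_fun measurableSet_Ioi h2,
    lintegral_mul_const _ (by fun_prop), Real.Gamma_eq_integral (by positivity),
    ofReal_integral_eq_lintegral_ofReal (Real.GammaIntegral_convergent (by positivity))]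
  filter_upwards [ae_restrict_mem measurableSet_Ioi] with s hs
  have : (0 : ℝ) < s := hs
  positivity

/-- The absolute moments of the marginals of the unit ball. -/
lemma setLIntegral_unitBall_abs_inner_rpow {α : ℝ} (hα : 0 < α) {θ : E} (hθ : ‖θ‖ = 1) :
    ∫⁻ x in Metric.closedBall (0 : E) 1, ENNReal.ofReal (|inner ℝ θ x| ^ α) =
      ENNReal.ofReal (Real.pi ^ (((Module.finrank ℝ E : ℝ) - 1) / 2) *
        Real.Gamma ((α + 1) / 2) / Real.Gamma ((Module.finrank ℝ E + α) / 2 + 1)) := by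
  have hG : 0 < Real.Gamma ((Module.finrank ℝ E + α) / 2 + 1) :=
    Real.Gamma_pos_of_pos (by positivity)
  have h := (lintegral_gaussian_eq_Gamma_mul hα θ).symm.trans
    (lintegral_abs_inner_rpow_mul_exp_neg_norm_sq hα hθ)
  rw [ENNReal.ofReal_div_of_pos hG, ← h, mul_comm, ENNReal.mul_div_cancel_right]
  · simpa using hG
  · exact ENNReal.ofReal_ne_top

end GaussianMoments

/-! ### The energy of balls -/

section BallEnergy

variable {E : Type*} [NormedAddCommGroup E] [InnerProductSpace ℝ E] [FiniteDimensional ℝ E]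
  [MeasurableSpace E] [BorelSpace E]

lemma volume_hyperplane_eq_zero {z : E} (hz : z ≠ 0) (t : ℝ) :
    volume {x : E | inner ℝ z x = t} = 0 := by
  have hz2 : inner ℝ z z ≠ (0 : ℝ) := inner_self_ne_zero.2 hz
  have h0 : volume {x : E | inner ℝ z x = 0} = 0 := by
    have h := Measure.addHaar_submodule (volume : Measure E)
      (LinearMap.ker (innerₛₗ ℝ z)) (fun htop => hz2 ?_)
    · convert h using 2
      ext x; simp
    · have : z ∈ LinearMap.ker (innerₛₗ ℝ z) := htop ▸ Submodule.mem_top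
      simpa using this
  rw [← h0, ← measure_preimage_add_right volume (-((t / inner ℝ z z) • z))
    {x : E | inner ℝ z x = 0}]
  congr 1
  ext x
  simp only [Set.mem_ofPred_eq, Set.mem_preimage, inner_add_right, inner_neg_right,
    inner_smul_right, div_mul_cancel₀ _ hz2]
  constructor <;> intro h <;> linarith

/-- The intersection of a centred ball with its translate by `z` has the volume of two opposite
caps of the ball. -/
lemma volume_closedBall_inter_translate (r : ℝ) {z : E} (hz : z ≠ 0) :
    volume {x : E | x ∈ Metric.closedBall 0 r ∧ x - z ∈ Metric.closedBall 0 r} =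
      volume {x : E | x ∈ Metric.closedBall 0 r ∧ ‖z‖ ^ 2 / 2 < |inner ℝ z x|} := by
  set B : Set E := Metric.closedBall 0 r
  have hB : MeasurableSet B := Metric.isClosed_closedBall.measurableSet
  set U : Set E := {x | ‖z‖ ^ 2 / 2 < inner ℝ z x}
  have hU : MeasurableSet U := measurableSet_lt measurable_const (by fun_prop)
  have hz0 : 0 < ‖z‖ ^ 2 := by positivity
  have hexp : ∀ x : E, ‖x - z‖ ^ 2 = ‖x‖ ^ 2 - 2 * inner ℝ z x + ‖z‖ ^ 2 := fun x => by
    rw [@norm_sub_sq_real, real_inner_comm]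
  have hD : {x : E | x ∈ B ∧ x - z ∈ B} =ᵐ[volume]
      (B ∩ U ∪ (fun x => z - x) ⁻¹' (B ∩ U) : Set E) := by
    have hnull : ∀ᵐ x : E, inner ℝ z x ≠ ‖z‖ ^ 2 / 2 :=
      measure_eq_zero_iff_ae_notMem.1 (volume_hyperplane_eq_zero hz _)
    refine Filter.eventuallyEq_set.2 ?_
    filter_upwards [hnull] with x hx
    simp only [Set.mem_ofPred_eq, Set.mem_union, Set.mem_inter_iff, Set.mem_preimage, B, U,
      mem_closedBall_zero_iff, inner_sub_right, real_inner_self_eq_norm_sq, norm_sub_rev z x]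
    constructor
    · rintro ⟨h1, h2⟩
      rcases lt_or_gt_of_ne hx with h | h
      · exact Or.inr ⟨h2, by linarith⟩
      · exact Or.inl ⟨h1, h⟩
    · rintro (⟨h1, h2⟩ | ⟨h1, h2⟩)
      · refine ⟨h1, le_trans (le_of_lt ?_) h1⟩
        refine lt_of_pow_lt_pow_left₀ 2 (norm_nonneg _) ?_
        rw [hexp]; linarith
      · refine ⟨le_trans (le_of_lt ?_) h1, h1⟩
        refine lt_of_pow_lt_pow_left₀ 2 (norm_nonneg _) ?_
        rw [hexp]; linarith
  have hcap : {x : E | x ∈ B ∧ ‖z‖ ^ 2 / 2 < |inner ℝ z x|} =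
      B ∩ U ∪ (fun x => -x) ⁻¹' (B ∩ U) := by
    ext x
    simp only [Set.mem_ofPred_eq, Set.mem_union, Set.mem_inter_iff, Set.mem_preimage, B, U,
      mem_closedBall_zero_iff, norm_neg, inner_neg_right, lt_abs]
    tauto
  rw [measure_congr hD, hcap, measure_union, measure_union,
    (Measure.measurePreserving_sub_left volume z).measure_preimage (hB.inter hU).nullMeasurableSet,
    (Measure.measurePreserving_neg volume).measure_preimage (hB.inter hU).nullMeasurableSet]
  · refine Set.disjoint_left.2 fun x h1 h2 => ?_
    have h1' : ‖z‖ ^ 2 / 2 < inner ℝ z x := h1.2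
    have h2' : ‖z‖ ^ 2 / 2 < inner ℝ z (-x) := h2.2
    rw [inner_neg_right] at h2'
    linarith
  · exact measurable_neg (hB.inter hU)
  · refine Set.disjoint_left.2 fun x h1 h2 => ?_
    have h1' : ‖z‖ ^ 2 / 2 < inner ℝ z x := h1.2
    have h2' : ‖z‖ ^ 2 / 2 < inner ℝ z (z - x) := h2.2
    rw [inner_sub_right, real_inner_self_eq_norm_sq] at h2'
    linarith
  · exact (measurable_const_sub z) (hB.inter hU)

/-- The energy of a set is the integral of the kernel against its covariogram. -/
lemma rieszEnergy_self_eq_lintegral_covariogram (β : ℝ) {A : Set E} (hA : MeasurableSet A) :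
    rieszEnergy β A A =
      ∫⁻ z : E, ENNReal.ofReal (‖z‖ ^ β) * volume {x : E | x ∈ A ∧ x - z ∈ A} := by
  have hmeas : Measurable fun p : E × E =>
      ENNReal.ofReal (‖p.2‖ ^ β) * A.indicator (1 : E → ℝ≥0∞) (p.1 - p.2) :=
    Measurable.mul (by fun_prop) ((measurable_one.indicator hA).comp (by fun_prop))
  have h1 : ∀ x : E, ∫⁻ y in A, ENNReal.ofReal (‖x - y‖ ^ β) =
      ∫⁻ z, ENNReal.ofReal (‖z‖ ^ β) * A.indicator (1 : E → ℝ≥0∞) (x - z) := by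
    intro x
    rw [← lintegral_indicator hA, ← lintegral_sub_left_eq_self _ x]
    refine lintegral_congr fun z => ?_
    by_cases h : x - z ∈ A <;> simp [h]
  unfold rieszEnergy
  simp_rw [h1]
  rw [lintegral_lintegral_swap hmeas.aemeasurable]
  refine lintegral_congr fun z => ?_
  have hz : MeasurableSet ((fun x => x - z) ⁻¹' A) := (measurable_sub_const z) hA
  rw [lintegral_const_mul _ (f := fun x => A.indicator (1 : E → ℝ≥0∞) (x - z))
    ((measurable_one.indicator hA).comp (by fun_prop))]
  congr 1
  rw [show {x : E | x ∈ A ∧ x - z ∈ A} = (fun x => x - z) ⁻¹' A ∩ A from Set.inter_comm _ _,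
    ← Measure.restrict_apply hz, ← lintegral_indicator_one hz]
  rfl

/-- Polar coordinates for the translation vector, followed by integration over its length, express
the energy of a ball by the moments of the ball in all directions. -/
lemma rieszEnergy_closedBall_eq_lintegral_sphere [Nontrivial E] {α : ℝ} (hα : 0 < α) (r : ℝ) :
    rieszEnergy (α - Module.finrank ℝ E) (Metric.closedBall (0 : E) r) (Metric.closedBall 0 r) =
      ∫⁻ θ : Metric.sphere (0 : E) 1, (ENNReal.ofReal (2 ^ α / α) *
        ∫⁻ x in Metric.closedBall (0 : E) r, ENNReal.ofReal (|inner ℝ (θ : E) x| ^ α))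
          ∂volume.toSphere := by
  set n := Module.finrank ℝ E
  set B : Set E := Metric.closedBall 0 r
  have hB : MeasurableSet B := Metric.isClosed_closedBall.measurableSet
  have hn : 0 < n := Module.finrank_pos
  have hcap : Measurable fun z : E => volume {x : E | x ∈ B ∧ ‖z‖ ^ 2 / 2 < |inner ℝ z x|} := by
    have h : MeasurableSet {p : E × E | ‖p.1‖ ^ 2 / 2 < |inner ℝ p.1 p.2|} :=
      measurableSet_lt (by fun_prop) (by fun_prop)
    exact measurable_measure_prodMk_left ((measurable_snd hB).inter h)
  have hae : ∀ᵐ z : E, z ≠ 0 := measure_eq_zero_iff_ae_notMem.1 (measure_singleton (0 : E))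
  rw [rieszEnergy_self_eq_lintegral_covariogram _ hB]
  rw [lintegral_congr_ae (g := fun z : E => ENNReal.ofReal (‖z‖ ^ (α - n)) *
    volume {x : E | x ∈ B ∧ ‖z‖ ^ 2 / 2 < |inner ℝ z x|})]
  swap
  · filter_upwards [hae] with z hz
    rw [volume_closedBall_inter_translate r hz]
  rw [lintegral_eq_lintegral_sphere_Ioi (f := fun z : E => ENNReal.ofReal (‖z‖ ^ (α - n)) *
    volume {x : E | x ∈ B ∧ ‖z‖ ^ 2 / 2 < |inner ℝ z x|}) (Measurable.mul (by fun_prop) hcap)]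
  refine lintegral_congr fun θ => ?_
  have hθ : ‖(θ : E)‖ = 1 := by simp
  have hlc := lintegral_rpow_eq_lintegral_meas_lt_mul (volume.restrict B)
    (f := fun x => 2 * |inner ℝ (θ : E) x|) (Filter.Eventually.of_forall fun x => by positivity)
    (by fun_prop) hα
  calc ∫⁻ s in Set.Ioi (0 : ℝ), ENNReal.ofReal (s ^ (n - 1)) *
        (ENNReal.ofReal (‖s • (θ : E)‖ ^ (α - n)) *
          volume {x : E | x ∈ B ∧ ‖s • (θ : E)‖ ^ 2 / 2 < |inner ℝ (s • (θ : E)) x|})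
      = ∫⁻ s in Set.Ioi (0 : ℝ), volume.restrict B {x : E | s < 2 * |inner ℝ (θ : E) x|} *
          ENNReal.ofReal (s ^ (α - 1)) := by
        refine setLIntegral_congr_fun measurableSet_Ioi fun s hs => ?_
        have hs' : (0 : ℝ) < s := hs
        have hset : {x : E | x ∈ B ∧ ‖s • (θ : E)‖ ^ 2 / 2 < |inner ℝ (s • (θ : E)) x|} =
            {x : E | s < 2 * |inner ℝ (θ : E) x|} ∩ B := by
          ext x
          simp only [Set.mem_ofPred_eq, Set.mem_inter_iff, norm_smul, hθ, mul_one,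
            Real.norm_of_nonneg hs'.le, real_inner_smul_left, abs_mul, abs_of_pos hs']
          rw [and_comm]
          refine and_congr_left fun _ => ?_
          constructor <;> intro h <;> nlinarith
        have hpow : s ^ (n - 1) * s ^ (α - n) = s ^ (α - 1) := by
          rw [← Real.rpow_natCast, ← Real.rpow_add hs', Nat.cast_sub hn]
          congr 1
          push_cast; ring
        rw [hset, Measure.restrict_apply (measurableSet_lt measurable_const (by fun_prop)),
          norm_smul, hθ, mul_one, Real.norm_of_nonneg hs'.le, ← mul_assoc,
          ← ENNReal.ofReal_mul (by positivity), hpow, mul_comm]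
    _ = ENNReal.ofReal (1 / α) *
          ∫⁻ x in B, ENNReal.ofReal ((2 * |inner ℝ (θ : E) x|) ^ α) := by
        rw [hlc, ← mul_assoc, ← ENNReal.ofReal_mul (by positivity), one_div_mul_cancel hα.ne',
          ENNReal.ofReal_one, one_mul]
    _ = _ := by
        have h2 : ∀ x : E, ENNReal.ofReal ((2 * |inner ℝ (θ : E) x|) ^ α) =
            ENNReal.ofReal (2 ^ α) * ENNReal.ofReal (|inner ℝ (θ : E) x| ^ α) := fun x => by
          rw [Real.mul_rpow two_pos.le (abs_nonneg _), ENNReal.ofReal_mul (by positivity)]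
        simp_rw [h2]
        rw [lintegral_const_mul _ (by fun_prop), ← mul_assoc, ← ENNReal.ofReal_mul (by positivity),
          one_div_mul_eq_div]

/-- The energy of a ball, in terms of its volume. -/
lemma rieszEnergy_closedBall [Nontrivial E] {α : ℝ} (hα : 0 < α) (x₀ : E) {r : ℝ} (hr : 0 < r) :
    rieszEnergy (α - Module.finrank ℝ E) (Metric.closedBall x₀ r) (Metric.closedBall x₀ r) =
      ENNReal.ofReal (chordSobolevConst (Module.finrank ℝ E) α) *
        volume (Metric.closedBall x₀ r) ^
          (((Module.finrank ℝ E : ℝ) + α) / (Module.finrank ℝ E : ℝ)) := by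
  have htrans : Metric.closedBall x₀ r = (fun x => x - x₀) ⁻¹' Metric.closedBall 0 r := by
    ext x; simp [dist_eq_norm]
  have hn : 0 < Module.finrank ℝ E := Module.finrank_pos
  have hn' : (0 : ℝ) < Module.finrank ℝ E := Nat.cast_pos.2 hn
  rw [InnerProductSpace.volume_closedBall, htrans,
    rieszEnergy_preimage _ (measurePreserving_sub_right volume x₀) (fun x y => by simp)
      Metric.isClosed_closedBall.measurableSet Metric.isClosed_closedBall.measurableSet,
    rieszEnergy_closedBall_eq_lintegral_sphere hα]
  have hθ : ∀ θ : Metric.sphere (0 : E) 1,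
      ∫⁻ x in Metric.closedBall (0 : E) r, ENNReal.ofReal (|inner ℝ (θ : E) x| ^ α) = _ :=
    fun θ => (setLIntegral_closedBall_abs_inner_rpow _ hr).trans
      (congrArg _ (setLIntegral_unitBall_abs_inner_rpow hα (by simp)))
  simp_rw [hθ]
  rw [lintegral_const, Measure.toSphere_apply_univ, InnerProductSpace.volume_ball]
  generalize Module.finrank ℝ E = n at *
  have hG1 : 0 < Real.Gamma ((n : ℝ) / 2 + 1) := Real.Gamma_pos_of_pos (by positivity)
  have hG2 : 0 < Real.Gamma ((n + α) / 2 + 1) := Real.Gamma_pos_of_pos (by positivity)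
  have hG3 : 0 < Real.Gamma ((α + 1) / 2) := Real.Gamma_pos_of_pos (by positivity)
  have hσ : 0 ≤ chordSobolevConst n α := by unfold chordSobolevConst; positivity
  rw [ENNReal.ofReal_one, one_pow, one_mul, ← ENNReal.ofReal_pow hr.le,
    ← ENNReal.ofReal_mul (by positivity), ← ENNReal.ofReal_mul (by positivity),
    ← ENNReal.ofReal_mul (by positivity), ENNReal.ofReal_rpow_of_pos (by positivity),
    ← ENNReal.ofReal_mul hσ, ← ENNReal.ofReal_natCast, ← ENNReal.ofReal_mul (by positivity),
    ← ENNReal.ofReal_mul (by positivity)]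
  congr 1
  have hπ := Real.pi_pos
  have hrpow : (r ^ n) ^ (((n : ℝ) + α) / n) = r ^ ((n : ℝ) + α) := by
    rw [← Real.rpow_natCast, ← Real.rpow_mul hr.le]
    congr 1; field_simp
  have hsq : √Real.pi ^ n = Real.pi ^ ((n : ℝ) / 2) := by
    rw [Real.sqrt_eq_rpow, ← Real.rpow_natCast, ← Real.rpow_mul hπ.le]
    congr 1; ring
  have hpipow : (Real.pi ^ ((n : ℝ) / 2)) ^ (((n : ℝ) + α) / n) =
      Real.pi ^ (((n : ℝ) + α) / 2) := by
    rw [← Real.rpow_mul hπ.le]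
    congr 1; field_simp
  have hG1pow : Real.Gamma ((n : ℝ) / 2 + 1) ^ (((n : ℝ) + α) / n) =
      Real.Gamma ((n : ℝ) / 2 + 1) * Real.Gamma ((n : ℝ) / 2 + 1) ^ (α / n) := by
    rw [add_div, div_self hn'.ne', Real.rpow_add hG1, Real.rpow_one]
  have hpi1 : Real.pi ^ (((n : ℝ) - α - 1) / 2) * Real.pi ^ (((n : ℝ) + α) / 2) =
      Real.pi ^ (((n : ℝ) - 1) / 2) * Real.pi ^ ((n : ℝ) / 2) := by
    rw [← Real.rpow_add hπ, ← Real.rpow_add hπ]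
    congr 1; ring
  have hG4 : 0 < Real.Gamma ((n : ℝ) / 2 + 1) ^ (α / n) := Real.rpow_pos_of_pos hG1 _
  rw [Real.mul_rpow (by positivity) (by positivity), hrpow,
    Real.div_rpow (by positivity) (by positivity), hsq, hpipow, hG1pow, chordSobolevConst,
    abs_of_pos hα]
  field_simp
  linear_combination (-1 : ℝ) * hpi1

end BallEnergy

/-! ### Riesz's inequality and its equality case -/

section Minimizers

variable {E : Type*} [NormedAddCommGroup E] [InnerProductSpace ℝ E] [FiniteDimensional ℝ E]
  [MeasurableSpace E] [BorelSpace E]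

lemma exists_volume_closedBall_eq [Nontrivial E] {V : ℝ≥0∞} (h0 : V ≠ 0) (hV : V ≠ ∞) :
    ∃ r : ℝ, 0 < r ∧ volume (Metric.closedBall (0 : E) r) = V := by
  have hn : Module.finrank ℝ E ≠ 0 := Module.finrank_pos.ne'
  set c : ℝ := √Real.pi ^ Module.finrank ℝ E / Real.Gamma (Module.finrank ℝ E / 2 + 1)
  have hc : 0 < c := div_pos (by positivity) (Real.Gamma_pos_of_pos (by positivity))
  have hv : 0 < V.toReal := ENNReal.toReal_pos h0 hV
  refine ⟨(V.toReal / c) ^ (1 / (Module.finrank ℝ E : ℝ)), by positivity, ?_⟩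
  rw [InnerProductSpace.volume_closedBall, ← ENNReal.ofReal_pow (by positivity),
    ← ENNReal.ofReal_mul (by positivity), one_div, Real.rpow_inv_natCast_pow (by positivity) hn,
    div_mul_cancel₀ _ hc.ne', ENNReal.ofReal_toReal hV]

/-- Balls minimize the energy of an increasing power kernel among sets of given volume. -/
lemma chordSobolevConst_mul_volume_rpow_le_rieszEnergy [Nontrivial E] {α : ℝ}
    (hα : (Module.finrank ℝ E : ℝ) < α) {A : Set E} (hA : MeasurableSet A) :
    ENNReal.ofReal (chordSobolevConst (Module.finrank ℝ E) α) *
        volume A ^ (((Module.finrank ℝ E : ℝ) + α) / (Module.finrank ℝ E : ℝ)) ≤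
      rieszEnergy (α - Module.finrank ℝ E) A A := by
  have hn : (0 : ℝ) < Module.finrank ℝ E := Nat.cast_pos.2 Module.finrank_pos
  have hα0 : 0 < α := hn.trans hα
  have hq : 0 < ((Module.finrank ℝ E : ℝ) + α) / (Module.finrank ℝ E : ℝ) := by positivity
  have hbdd : ∀ k : ℕ, ENNReal.ofReal (chordSobolevConst (Module.finrank ℝ E) α) *
        volume (A ∩ Metric.closedBall 0 k) ^
          (((Module.finrank ℝ E : ℝ) + α) / (Module.finrank ℝ E : ℝ)) ≤
      rieszEnergy (α - Module.finrank ℝ E) A A := by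
    intro k
    by_cases h0 : volume (A ∩ Metric.closedBall 0 k) = 0
    · rw [h0, ENNReal.zero_rpow_of_pos hq, mul_zero]; exact zero_le
    have hfin : volume (A ∩ Metric.closedBall 0 k) ≠ ∞ :=
      measure_ne_top_of_subset Set.inter_subset_right measure_closedBall_lt_top.ne
    obtain ⟨r, hr, hvol⟩ := exists_volume_closedBall_eq (E := E) h0 hfin
    rw [← hvol, ← rieszEnergy_closedBall hα0 0 hr]
    exact (rieszEnergy_closedBall_le_of_subset (sub_pos.2 hα).le
      (hA.inter Metric.isClosed_closedBall.measurableSet) Set.inter_subset_right hvol.symm).trans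
      (rieszEnergy_mono _ Set.inter_subset_left Set.inter_subset_left)
  have hmono : Monotone fun k : ℕ => A ∩ Metric.closedBall (0 : E) k := fun i j hij =>
    Set.inter_subset_inter_right _ (Metric.closedBall_subset_closedBall (Nat.cast_le.2 hij))
  have hlim := tendsto_measure_iUnion_atTop (μ := volume) hmono
  rw [← Set.inter_iUnion, Metric.iUnion_closedBall_nat, Set.inter_univ] at hlim
  refine le_of_tendsto' (ENNReal.Tendsto.const_mul
    ((ENNReal.continuous_rpow_const.tendsto _).comp hlim) (Or.inr ENNReal.ofReal_ne_top)) hbdd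

/-- For a minimizer, the unmatched points lie on one side of every hyperplane. -/
lemma volume_unmatched_eq_zero_of_rieszEnergy_le [Nontrivial E] {α : ℝ}
    (hα : (Module.finrank ℝ E : ℝ) < α) {A : Set E} (hA : MeasurableSet A) (hfin : volume A ≠ ∞)
    (hle : rieszEnergy (α - Module.finrank ℝ E) A A ≤
      ENNReal.ofReal (chordSobolevConst (Module.finrank ℝ E) α) *
        volume A ^ (((Module.finrank ℝ E : ℝ) + α) / (Module.finrank ℝ E : ℝ)))
    {e : E} (he : ‖e‖ = 1) (t : ℝ) :
    volume (upperUnmatched e t A) = 0 ∨ volume (lowerUnmatched e t A) = 0 := by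
  have hn : (0 : ℝ) < Module.finrank ℝ E := Nat.cast_pos.2 Module.finrank_pos
  have hα0 : 0 < α := hn.trans hα
  refine volume_unmatched_eq_zero_of_le (sub_pos.2 hα) he t hA (ne_top_of_le_ne_top ?_ hle) ?_
  · exact ENNReal.mul_ne_top ENNReal.ofReal_ne_top
      (ENNReal.rpow_ne_top_of_nonneg (by positivity) hfin)
  · refine hle.trans ?_
    rw [← volume_polarization he hA (t := t)]
    exact chordSobolevConst_mul_volume_rpow_le_rieszEnergy hα (measurableSet_polarization hA)

/-- Every set of finite volume is halved by some hyperplane with given normal. -/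
lemma exists_volume_inter_halfSpace_eq {A : Set E} (hfin : volume A ≠ ∞) {e : E} (he : e ≠ 0) :
    ∃ t : ℝ, volume (A ∩ {x | t < inner ℝ e x}) = volume (A ∩ {x | inner ℝ e x < t}) := by
  have : IsFiniteMeasure (volume.restrict A) := isFiniteMeasure_restrict.2 hfin
  by_cases h0 : volume A = 0
  · exact ⟨0, by rw [measure_mono_null Set.inter_subset_left h0,
      measure_mono_null Set.inter_subset_left h0]⟩
  have hV : 0 < volume.real A := ENNReal.toReal_pos h0 hfin
  -- `f` is the sign function, so `G t` is the difference of the volumes on the two sides; it is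
  -- continuous because hyperplanes are null sets
  set f : ℝ → ℝ := fun u => (Set.Ioi 0).indicator 1 u - (Set.Iio 0).indicator 1 u
  have hf : Measurable f :=
    (measurable_one.indicator measurableSet_Ioi).sub (measurable_one.indicator measurableSet_Iio)
  have hf1 : ∀ u, 0 < u → f u = 1 := fun u hu => by simp [f, hu, hu.le]
  have hf2 : ∀ u, u < 0 → f u = -1 := fun u hu => by simp [f, hu, hu.le]
  have hfb : ∀ u, ‖f u‖ ≤ 1 := fun u => by
    rcases lt_trichotomy u 0 with h | h | h
    · simp [hf2 u h]
    · simp [f, h]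
    · simp [hf1 u h]
  have hcomp : ∀ t : ℝ, Measurable fun x : E => f (t - inner ℝ e x) := fun t =>
    hf.comp (by fun_prop)
  set G : ℝ → ℝ := fun t => ∫ x in A, f (t - inner ℝ e x)
  have hGcont : Continuous G := by
    refine continuous_iff_continuousAt.2 fun t₀ => continuousAt_of_dominated
      (bound := fun _ => 1) (Filter.Eventually.of_forall fun t => (hcomp t).aestronglyMeasurable)
      (Filter.Eventually.of_forall fun t => Filter.Eventually.of_forall fun x => hfb _)
      (integrable_const _) (ae_restrict_of_ae ?_)
    have hnull : ∀ᵐ x : E, inner ℝ e x ≠ t₀ :=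
      measure_eq_zero_iff_ae_notMem.1 (volume_hyperplane_eq_zero he t₀)
    filter_upwards [hnull] with x hx
    rcases lt_or_gt_of_ne hx with h | h
    · refine (continuousAt_const (y := (1 : ℝ))).congr ?_
      filter_upwards [lt_mem_nhds h] with t ht
      exact (hf1 _ (sub_pos.2 ht)).symm
    · refine (continuousAt_const (y := (-1 : ℝ))).congr ?_
      filter_upwards [gt_mem_nhds h] with t ht
      exact (hf2 _ (sub_neg.2 ht)).symm
  have htop : Filter.Tendsto G Filter.atTop (nhds (∫ _ in A, (1 : ℝ))) := by
    refine tendsto_integral_filter_of_dominated_convergence (fun _ => 1)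
      (Filter.Eventually.of_forall fun t => (hcomp t).aestronglyMeasurable)
      (Filter.Eventually.of_forall fun t => Filter.Eventually.of_forall fun x => hfb _)
      (integrable_const _) (Filter.Eventually.of_forall fun x => ?_)
    refine tendsto_const_nhds.congr' ?_
    filter_upwards [Filter.eventually_gt_atTop (inner ℝ e x)] with t ht
    exact (hf1 _ (sub_pos.2 ht)).symm
  have hbot : Filter.Tendsto G Filter.atBot (nhds (∫ _ in A, (-1 : ℝ))) := by
    refine tendsto_integral_filter_of_dominated_convergence (fun _ => 1)
      (Filter.Eventually.of_forall fun t => (hcomp t).aestronglyMeasurable)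
      (Filter.Eventually.of_forall fun t => Filter.Eventually.of_forall fun x => hfb _)
      (integrable_const _) (Filter.Eventually.of_forall fun x => ?_)
    refine tendsto_const_nhds.congr' ?_
    filter_upwards [Filter.eventually_lt_atBot (inner ℝ e x)] with t ht
    exact (hf2 _ (sub_neg.2 ht)).symm
  rw [setIntegral_const, smul_eq_mul, mul_one] at htop
  rw [setIntegral_const, smul_eq_mul, mul_neg_one] at hbot
  obtain ⟨t₁, ht₁⟩ := (htop.eventually (lt_mem_nhds hV)).exists
  obtain ⟨t₂, ht₂⟩ := (hbot.eventually (gt_mem_nhds (neg_neg_of_pos hV))).exists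
  obtain ⟨t, ht⟩ := mem_range_of_exists_le_of_exists_ge hGcont ⟨t₂, ht₂.le⟩ ⟨t₁, ht₁.le⟩
  have hup : MeasurableSet {x : E | t < inner ℝ e x} :=
    measurableSet_lt measurable_const (by fun_prop)
  have hlo : MeasurableSet {x : E | inner ℝ e x < t} :=
    measurableSet_lt (by fun_prop) measurable_const
  have hG : G t = volume.real (A ∩ {x | inner ℝ e x < t}) -
      volume.real (A ∩ {x | t < inner ℝ e x}) := by
    have hfx : ∀ x : E, f (t - inner ℝ e x) = {x : E | inner ℝ e x < t}.indicator 1 x -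
        {x : E | t < inner ℝ e x}.indicator 1 x := fun x => by
      simp [f, Set.indicator_apply]
    simp only [G, hfx]
    have hi : ∀ s : Set E, MeasurableSet s →
        Integrable (s.indicator (1 : E → ℝ)) (volume.restrict A) := fun s hs =>
      (integrable_const (1 : ℝ)).indicator hs
    rw [integral_sub (hi _ hlo) (hi _ hup), integral_indicator_one hlo,
      integral_indicator_one hup, measureReal_restrict_apply hlo, measureReal_restrict_apply hup,
      Set.inter_comm _ A, Set.inter_comm _ A]
  refine ⟨t, (measureReal_eq_measureReal_iff (measure_ne_top_of_subset Set.inter_subset_left hfin)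
    (measure_ne_top_of_subset Set.inter_subset_left hfin)).1 ?_⟩
  linarith

/-- The two sides of a set differ in volume by the unmatched parts. -/
lemma exists_volume_inter_halfSpace_eq_add {e : E} (he : ‖e‖ = 1) (t : ℝ) {A : Set E}
    (hA : MeasurableSet A) (hfin : volume A ≠ ∞) :
    ∃ M : ℝ≥0∞, M ≠ ∞ ∧
      volume (A ∩ {x | t < inner ℝ e x}) = M + volume (upperUnmatched e t A) ∧
      volume (A ∩ {x | inner ℝ e x < t}) = M + volume (lowerUnmatched e t A) := by
  have hS := measurableSet_matched (e := e) (t := t) hA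
  have hU := measurableSet_upperUnmatched (e := e) (t := t) hA
  have hL := measurableSet_lowerUnmatched (e := e) (t := t) hA
  have hup : MeasurableSet {x : E | t < inner ℝ e x} :=
    measurableSet_lt measurable_const (by fun_prop)
  have hlo : MeasurableSet {x : E | inner ℝ e x < t} :=
    measurableSet_lt (by fun_prop) measurable_const
  refine ⟨volume (matched e t A ∩ {x | t < inner ℝ e x}), measure_ne_top_of_subset
    (Set.inter_subset_left.trans Set.inter_subset_left) hfin, ?_, ?_⟩
  · rw [← measure_union (disjoint_matched_upperUnmatched.mono_left Set.inter_subset_left) hU]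
    congr 1
    ext x
    simp only [matched, upperUnmatched, Set.mem_union, Set.mem_inter_iff, Set.mem_preimage,
      Set.mem_compl_iff, Set.mem_ofPred_eq]
    tauto
  · have hflip : matched e t A ∩ {x | t < inner ℝ e x} =
        hyperplaneReflection e t ⁻¹' (matched e t A ∩ {x | inner ℝ e x < t}) := by
      rw [Set.preimage_inter, preimage_matched he]
      congr 1
      ext x
      simp only [Set.mem_preimage, Set.mem_ofPred_eq, inner_hyperplaneReflection he]
      constructor <;> intro h <;> linarith
    rw [hflip, (measurePreserving_hyperplaneReflection he t).measure_preimage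
      (hS.inter hlo).nullMeasurableSet, ← measure_union _ hL]
    · congr 1
      ext x
      simp only [matched, lowerUnmatched, Set.mem_union, Set.mem_inter_iff, Set.mem_preimage,
        Set.mem_compl_iff, Set.mem_ofPred_eq]
      tauto
    · exact disjoint_lowerUnmatched.mono_left
        (Set.inter_subset_left.trans Set.subset_union_left)

/-- A set whose unmatched points lie on one side of a halving hyperplane is symmetric about it. -/
lemma ae_eq_preimage_hyperplaneReflection {e : E} (he : ‖e‖ = 1) {t : ℝ} {A : Set E}
    (hA : MeasurableSet A) (hfin : volume A ≠ ∞)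
    (hhalf : volume (A ∩ {x | t < inner ℝ e x}) = volume (A ∩ {x | inner ℝ e x < t}))
    (hside : volume (upperUnmatched e t A) = 0 ∨ volume (lowerUnmatched e t A) = 0) :
    A =ᵐ[volume] hyperplaneReflection e t ⁻¹' A := by
  obtain ⟨M, hM, hU, hL⟩ := exists_volume_inter_halfSpace_eq_add he t hA hfin
  rw [hU, hL] at hhalf
  have heq := (ENNReal.add_right_inj hM).1 hhalf
  have hU0 : volume (upperUnmatched e t A) = 0 := hside.elim id fun h => heq.trans h
  have hL0 : volume (lowerUnmatched e t A) = 0 := heq ▸ hU0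
  have hmatch : A =ᵐ[volume] matched e t A := by
    conv_lhs => rw [← matched_union_unmatched e t A]
    exact (union_ae_eq_left_of_ae_eq_empty (ae_eq_empty.2 hL0)).trans
      (union_ae_eq_left_of_ae_eq_empty (ae_eq_empty.2 hU0))
  have h := (measurePreserving_hyperplaneReflection he t).quasiMeasurePreserving.preimage_ae_eq
    hmatch
  rw [preimage_matched he] at h
  exact hmatch.trans h.symm

/-- A set symmetric about one hyperplane in each direction of an orthonormal basis is symmetric
about their common point. -/
lemma exists_ae_eq_preimage_two_smul_sub {A : Set E}
    (hsymm : ∀ e : E, ‖e‖ = 1 → ∃ t, A =ᵐ[volume] hyperplaneReflection e t ⁻¹' A) :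
    ∃ c : E, A =ᵐ[volume] (fun x => (2 : ℝ) • c - x) ⁻¹' A := by
  set b := stdOrthonormalBasis ℝ E
  have hb : ∀ i, ‖b i‖ = 1 := b.orthonormal.1
  choose t ht using fun i => hsymm (b i) (hb i)
  -- the maps in `key` are the compositions of the reflections with index in `s`
  have key : ∀ s : Finset (Fin (Module.finrank ℝ E)),
      MeasurePreserving (fun x => x + ∑ i ∈ s, (2 * (t i - inner ℝ (b i) x)) • b i) ∧
      A =ᵐ[volume] (fun x => x + ∑ i ∈ s, (2 * (t i - inner ℝ (b i) x)) • b i) ⁻¹' A := by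
    intro s
    induction s using Finset.induction_on with
    | empty =>
      simp only [Finset.sum_empty, add_zero]
      exact ⟨MeasurePreserving.id _, ae_eq_refl _⟩
    | insert j s hj ih =>
      have hstep : (fun x => x + ∑ i ∈ insert j s, (2 * (t i - inner ℝ (b i) x)) • b i) =
          hyperplaneReflection (b j) (t j) ∘
            fun x => x + ∑ i ∈ s, (2 * (t i - inner ℝ (b i) x)) • b i := by
        funext x
        have hin : inner ℝ (b j) (x + ∑ i ∈ s, (2 * (t i - inner ℝ (b i) x)) • b i) =
            inner ℝ (b j) x := by
          rw [inner_add_right, inner_sum, Finset.sum_eq_zero, add_zero]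
          intro i hi
          rw [inner_smul_right, b.orthonormal.2 (ne_of_mem_of_not_mem hi hj).symm, mul_zero]
        rw [Function.comp_apply, hyperplaneReflection, hin, Finset.sum_insert hj]
        abel
      rw [hstep]
      refine ⟨(measurePreserving_hyperplaneReflection (hb j) (t j)).comp ih.1, ?_⟩
      rw [Set.preimage_comp]
      exact ih.2.trans (ih.1.quasiMeasurePreserving.preimage_ae_eq (ht j))
  refine ⟨∑ i, t i • b i, ?_⟩
  have hfun : (fun x : E => (2 : ℝ) • ∑ i, t i • b i - x) =
      fun x => x + ∑ i, (2 * (t i - inner ℝ (b i) x)) • b i := ?_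
  · rw [hfun]
    exact (key Finset.univ).2
  funext x
  have hx := b.sum_repr' x
  conv_lhs => rw [← hx]
  conv_rhs => enter [1]; rw [← hx]
  rw [Finset.smul_sum, ← Finset.sum_sub_distrib, ← Finset.sum_add_distrib]
  refine Finset.sum_congr rfl fun i _ => ?_
  rw [smul_smul, ← sub_smul, ← add_smul]
  congr 1
  ring

/-- A set symmetric about the origin whose unmatched points always lie on one side is a ball: the
side is the one containing the origin, so that no reflection can map the part outside the ball into
the missing part of the ball. -/
lemma ae_eq_closedBall_of_symmetric [Nontrivial E] {A : Set E} (hA : MeasurableSet A)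
    {r : ℝ} (hvol : volume A = volume (Metric.closedBall (0 : E) r))
    (hneg : A =ᵐ[volume] (fun x => -x) ⁻¹' A)
    (hside : ∀ e : E, ‖e‖ = 1 → ∀ t,
      volume (upperUnmatched e t A) = 0 ∨ volume (lowerUnmatched e t A) = 0) :
    A =ᵐ[volume] Metric.closedBall (0 : E) r := by
  set B : Set E := Metric.closedBall 0 r
  have hB : MeasurableSet B := Metric.isClosed_closedBall.measurableSet
  have hBfin : volume B ≠ ∞ := measure_closedBall_lt_top.ne
  have hfin : volume A ≠ ∞ := hvol ▸ hBfin
  -- For `t < 0` the lower side does not contain the origin, so by symmetry it carries at most half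
  -- of `A`, and the unmatched points are on the upper side.
  have hlower : ∀ e : E, ‖e‖ = 1 → ∀ t < 0, volume (lowerUnmatched e t A) = 0 := by
    intro e he t ht
    obtain ⟨M, hM, hU, hL⟩ := exists_volume_inter_halfSpace_eq_add he t hA hfin
    have hup : MeasurableSet {x : E | -t < inner ℝ e x} :=
      measurableSet_lt measurable_const (by fun_prop)
    have hle : volume (A ∩ {x | inner ℝ e x < t}) ≤ volume (A ∩ {x | t < inner ℝ e x}) :=
      calc volume (A ∩ {x | inner ℝ e x < t})
          = volume ((fun x => -x) ⁻¹' A ∩ {x | inner ℝ e x < t}) :=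
            measure_congr (hneg.inter (ae_eq_refl _))
        _ = volume ((fun x => -x) ⁻¹' (A ∩ {x | -t < inner ℝ e x})) := by
            rw [Set.preimage_inter]
            congr 2
            ext x
            simp
        _ = volume (A ∩ {x | -t < inner ℝ e x}) :=
            (Measure.measurePreserving_neg volume).measure_preimage
              (hA.inter hup).nullMeasurableSet
        _ ≤ _ := by
            refine measure_mono (Set.inter_subset_inter_right _ fun x hx => ?_)
            have hx' : -t < inner ℝ e x := hx
            show t < inner ℝ e x
            linarith
    rw [hU, hL] at hle
    have hle' := (ENNReal.add_le_add_iff_left hM).1 hle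
    exact (hside e he t).elim (fun h => le_antisymm (hle'.trans h.le) zero_le) id
  have hprod : ∀ k : ℕ, volume ((A \ B) ∩ Metric.closedBall 0 k) * volume (B \ A) = 0 := by
    intro k
    refine le_antisymm ?_ zero_le
    refine (volume_mul_volume_le_of_overlap_le (R := max k r) (K := 0)
      ((hA.diff hB).inter Metric.isClosed_closedBall.measurableSet) (hB.diff hA)
      (fun x hx => (mem_closedBall_zero_iff.1 hx.2).trans (le_max_left _ _))
      (fun x hx => (mem_closedBall_zero_iff.1 hx.1).trans (le_max_right _ _))
      (fun x hx y hy => (mem_closedBall_zero_iff.1 hy.1).trans_lt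
        (not_le.1 fun h => hx.1.2 (mem_closedBall_zero_iff.2 h))) ?_).trans (by rw [mul_zero])
    intro e he t ht
    rw [← hlower e he t ht]
    refine measure_mono fun x hx => ⟨hx.1.1.1, ?_, hx.2.2⟩
    refine (norm_hyperplaneReflection_lt_iff he ht).1 ?_
    exact (mem_closedBall_zero_iff.1 hx.2.1).trans_lt
      (not_le.1 fun h => hx.1.1.2 (mem_closedBall_zero_iff.2 h))
  obtain ⟨h1, h2⟩ := volume_real_sdiff_eq_of_volume_eq hA hB hBfin hvol
  have hAB : volume (A \ B) = volume (B \ A) :=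
    (measureReal_eq_measureReal_iff (measure_ne_top_of_subset Set.sdiff_subset hfin)
      (measure_ne_top_of_subset Set.sdiff_subset hBfin)).1 (h1.trans h2.symm)
  have hBA : volume (B \ A) = 0 := by
    by_contra hne
    have hk : ∀ k : ℕ, volume ((A \ B) ∩ Metric.closedBall 0 k) = 0 := fun k =>
      (mul_eq_zero.1 (hprod k)).resolve_right hne
    have := measure_iUnion_null hk
    rw [← Set.inter_iUnion, Metric.iUnion_closedBall_nat, Set.inter_univ] at this
    exact hne (hAB ▸ this)
  exact Filter.EventuallyLE.antisymm (ae_le_set.2 (hAB.trans hBA)) (ae_le_set.2 hBA)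

/-- The only minimizers are balls. -/
lemma exists_ae_eq_closedBall_of_rieszEnergy_le [Nontrivial E] {α : ℝ}
    (hα : (Module.finrank ℝ E : ℝ) < α) {A : Set E} (hA : MeasurableSet A) (h0 : volume A ≠ 0)
    (hfin : volume A ≠ ∞)
    (hle : rieszEnergy (α - Module.finrank ℝ E) A A ≤
      ENNReal.ofReal (chordSobolevConst (Module.finrank ℝ E) α) *
        volume A ^ (((Module.finrank ℝ E : ℝ) + α) / (Module.finrank ℝ E : ℝ))) :
    ∃ (x₀ : E) (r : ℝ), 0 < r ∧ A =ᵐ[volume] Metric.closedBall x₀ r := by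
  obtain ⟨c, hc⟩ := exists_ae_eq_preimage_two_smul_sub (A := A) fun e he => by
    obtain ⟨t, ht⟩ := exists_volume_inter_halfSpace_eq hfin (e := e)
      (by rintro rfl; simp at he)
    exact ⟨t, ae_eq_preimage_hyperplaneReflection he hA hfin ht
      (volume_unmatched_eq_zero_of_rieszEnergy_le hα hA hfin hle he t)⟩
  have htrans := measurePreserving_add_right (volume : Measure E) c
  set A' : Set E := (fun x => x + c) ⁻¹' A
  have hA' : MeasurableSet A' := htrans.measurable hA
  have hvol : volume A' = volume A := htrans.measure_preimage hA.nullMeasurableSet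
  have hE : rieszEnergy (α - Module.finrank ℝ E) A' A' =
      rieszEnergy (α - Module.finrank ℝ E) A A :=
    rieszEnergy_preimage _ htrans (fun x y => by simp) hA hA
  obtain ⟨r, hr, hr'⟩ := exists_volume_closedBall_eq (E := E) h0 hfin
  have hneg : A' =ᵐ[volume] (fun x => -x) ⁻¹' A' := by
    have h : (fun x => -x) ⁻¹' A' = (fun x => x + c) ⁻¹' ((fun x => (2 : ℝ) • c - x) ⁻¹' A) := by
      ext x
      simp only [A', Set.mem_preimage, two_smul]
      rw [show c + c - (x + c) = -x + c by abel]
    rw [h]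
    exact htrans.quasiMeasurePreserving.preimage_ae_eq hc
  have hball := ae_eq_closedBall_of_symmetric hA' (hvol.trans hr'.symm) hneg fun e he t =>
    volume_unmatched_eq_zero_of_rieszEnergy_le hα hA' (hvol ▸ hfin) (by rw [hE, hvol]; exact hle)
      he t
  refine ⟨c, r, hr, ?_⟩
  have h := (measurePreserving_sub_right (volume : Measure E) c).quasiMeasurePreserving.preimage_ae_eq
    hball
  have h1 : (fun x => x - c) ⁻¹' A' = A := by ext x; simp [A']
  have h2 : (fun x => x - c) ⁻¹' Metric.closedBall 0 r = Metric.closedBall c r := by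
    ext x; simp [dist_eq_norm]
  rwa [h1, h2] at h

end Minimizers

/-! ### Layer cake representation and Jensen's inequality -/

section LayerCake

variable {n : ℕ} {α : ℝ}

lemma minEnergy_congr {f g : EuclideanSpace ℝ (Fin n) → ℝ} (h : f =ᵐ[volume] g) :
    minEnergy n α f = minEnergy n α g := by
  refine lintegral_congr_ae ?_
  filter_upwards [h] with x hx
  refine lintegral_congr_ae ?_
  filter_upwards [h] with y hy
  rw [hx, hy]

/-- The integrand `1_{t < g x} 1_{t < g y} |x - y|^β` of the layer cake representation of
`minEnergy`, as a function of `((t, x), y)`. -/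
noncomputable def superlevelKernel (g : EuclideanSpace ℝ (Fin n) → ℝ) (β : ℝ) :
    (ℝ × EuclideanSpace ℝ (Fin n)) × EuclideanSpace ℝ (Fin n) → ℝ≥0∞ :=
  ({q | q.1.1 < g q.1.2} ∩ {q | q.1.1 < g q.2}).indicator
    fun q => ENNReal.ofReal (‖q.1.2 - q.2‖ ^ β)

lemma measurable_superlevelKernel {g : EuclideanSpace ℝ (Fin n) → ℝ} (hg : Measurable g)
    (β : ℝ) : Measurable (superlevelKernel g β) := by
  have h1 : MeasurableSet {q : (ℝ × EuclideanSpace ℝ (Fin n)) × EuclideanSpace ℝ (Fin n) |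
      q.1.1 < g q.1.2} := measurableSet_lt (by fun_prop) (by fun_prop)
  have h2 : MeasurableSet {q : (ℝ × EuclideanSpace ℝ (Fin n)) × EuclideanSpace ℝ (Fin n) |
      q.1.1 < g q.2} := measurableSet_lt (by fun_prop) (by fun_prop)
  exact Measurable.indicator (by fun_prop) (h1.inter h2)

lemma rieszEnergy_superlevel {g : EuclideanSpace ℝ (Fin n) → ℝ} (hg : Measurable g) (β t : ℝ) :
    rieszEnergy β {x | t < g x} {x | t < g x} =
      ∫⁻ x, ∫⁻ y, superlevelKernel g β ((t, x), y) := by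
  have ht : MeasurableSet {x | t < g x} := measurableSet_lt measurable_const hg
  unfold rieszEnergy
  rw [← lintegral_indicator ht]
  refine lintegral_congr fun x => ?_
  by_cases hx : t < g x
  · rw [Set.indicator_of_mem (s := {x | t < g x}) hx, ← lintegral_indicator ht]
    refine lintegral_congr fun y => ?_
    simp [superlevelKernel, Set.indicator_apply, hx]
  · rw [Set.indicator_of_notMem (s := {x | t < g x}) hx]
    simp [superlevelKernel, hx]

lemma measurable_rieszEnergy_superlevel {g : EuclideanSpace ℝ (Fin n) → ℝ} (hg : Measurable g)
    (β : ℝ) : Measurable fun t : ℝ => rieszEnergy β {x | t < g x} {x | t < g x} := by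
  simp_rw [rieszEnergy_superlevel hg]
  exact Measurable.lintegral_prod_right' (Measurable.lintegral_prod_right'
    (measurable_superlevelKernel hg β))

/-- Layer cake representation: `minEnergy` integrates the energies of the superlevel sets. -/
lemma minEnergy_eq_lintegral_rieszEnergy {g : EuclideanSpace ℝ (Fin n) → ℝ} (hg : Measurable g)
    (h0 : ∀ x, 0 ≤ g x) :
    minEnergy n α g =
      ∫⁻ t in Set.Ioi (0 : ℝ), rieszEnergy (α - n) {x | t < g x} {x | t < g x} := by
  have hm := measurable_superlevelKernel hg (α - n)
  have hm' : ∀ x, Measurable fun p : ℝ × EuclideanSpace ℝ (Fin n) =>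
      superlevelKernel g (α - n) ((p.1, x), p.2) := fun x => hm.comp (by fun_prop)
  simp_rw [rieszEnergy_superlevel hg]
  rw [lintegral_lintegral_swap (Measurable.lintegral_prod_right' hm).aemeasurable]
  refine lintegral_congr fun x => ?_
  rw [lintegral_lintegral_swap (f := fun t y => superlevelKernel g (α - n) ((t, x), y))
    (hm' x).aemeasurable]
  refine lintegral_congr fun y => ?_
  have hind : ∀ t : ℝ, superlevelKernel g (α - n) ((t, x), y) =
      (Set.Iio (min (g x) (g y))).indicator
        (fun _ => ENNReal.ofReal (‖x - y‖ ^ (α - n))) t := fun t => by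
    simp [superlevelKernel, Set.indicator_apply]
  simp_rw [hind]
  rw [lintegral_indicator measurableSet_Iio, setLIntegral_const,
    Measure.restrict_apply measurableSet_Iio, Set.Iio_inter_Ioi, Real.volume_Ioo, sub_zero,
    ENNReal.ofReal_mul (le_min (h0 x) (h0 y)), mul_comm]

/-- Bernoulli's inequality in the form of a tangent line bound. -/
lemma ofReal_mul_le_rpow_add {q : ℝ} (hq : 1 < q) {u : ℝ≥0∞} (hu : u ≠ ∞) :
    ENNReal.ofReal q * u ≤ u ^ q + ENNReal.ofReal (q - 1) ∧
      (ENNReal.ofReal q * u = u ^ q + ENNReal.ofReal (q - 1) → u = 1) := by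
  lift u to NNReal using hu
  have h0 : (0 : ℝ) ≤ u := u.2
  have e1 : ENNReal.ofReal q * u = ENNReal.ofReal (q * u) := by
    rw [ENNReal.ofReal_mul (by linarith), ENNReal.ofReal_coe_nnreal]
  have e2 : (u : ℝ≥0∞) ^ q + ENNReal.ofReal (q - 1) = ENNReal.ofReal ((u : ℝ) ^ q + (q - 1)) := by
    rw [ENNReal.ofReal_add (by positivity) (by linarith),
      ← ENNReal.ofReal_rpow_of_nonneg h0 (by linarith), ENNReal.ofReal_coe_nnreal]
  rw [e1, e2]
  by_cases h1 : (u : ℝ) = 1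
  · refine ⟨ENNReal.ofReal_le_ofReal (by rw [h1]; simp), fun _ => ?_⟩
    exact_mod_cast h1
  · have h := one_add_mul_self_lt_rpow_one_add (s := (u : ℝ) - 1) (by linarith)
      (sub_ne_zero.2 h1) hq
    rw [add_sub_cancel] at h
    have hlt : ENNReal.ofReal (q * u) < ENNReal.ofReal ((u : ℝ) ^ q + (q - 1)) :=
      (ENNReal.ofReal_lt_ofReal_iff (by nlinarith [Real.rpow_nonneg h0 q])).2 (by linarith)
    exact ⟨hlt.le, fun h => absurd h hlt.ne⟩

/-- Jensen's inequality for `u ↦ u ^ q` and a function of mean `1`, with its equality case. -/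
lemma measure_univ_le_lintegral_rpow {X : Type*} [MeasurableSpace X] {μ : Measure X}
    [IsFiniteMeasure μ] {q : ℝ} (hq : 1 < q) {u : X → ℝ≥0∞} (hu : Measurable u)
    (hfin : ∀ᵐ x ∂μ, u x ≠ ∞) (hmean : ∫⁻ x, u x ∂μ = μ Set.univ) :
    μ Set.univ ≤ ∫⁻ x, u x ^ q ∂μ ∧
      (∫⁻ x, u x ^ q ∂μ ≤ μ Set.univ → ∀ᵐ x ∂μ, u x = 1) := by
  have hq1 : 0 ≤ q - 1 := by linarith
  have hle : (fun x => ENNReal.ofReal q * u x) ≤ᵐ[μ]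
      fun x => u x ^ q + ENNReal.ofReal (q - 1) := by
    filter_upwards [hfin] with x hx
    exact (ofReal_mul_le_rpow_add hq hx).1
  have hleft : ∫⁻ x, ENNReal.ofReal q * u x ∂μ =
      μ Set.univ + ENNReal.ofReal (q - 1) * μ Set.univ := by
    rw [lintegral_const_mul _ hu, hmean]
    nth_rewrite 2 [← one_mul (μ Set.univ)]
    rw [← add_mul, ← ENNReal.ofReal_one, ← ENNReal.ofReal_add zero_le_one hq1, add_sub_cancel]
  have hright : ∫⁻ x, (u x ^ q + ENNReal.ofReal (q - 1)) ∂μ =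
      ∫⁻ x, u x ^ q ∂μ + ENNReal.ofReal (q - 1) * μ Set.univ := by
    rw [lintegral_add_right _ measurable_const, lintegral_const]
  have htop : ENNReal.ofReal (q - 1) * μ Set.univ ≠ ∞ :=
    ENNReal.mul_ne_top ENNReal.ofReal_ne_top (measure_ne_top _ _)
  refine ⟨?_, fun h => ?_⟩
  · have := lintegral_mono_ae hle
    rw [hleft, hright] at this
    exact (ENNReal.add_le_add_iff_right htop).1 this
  · have heq := ae_eq_of_ae_le_of_lintegral_le hle
      (by rw [hleft]; exact ENNReal.add_ne_top.2 ⟨measure_ne_top _ _, htop⟩)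
      (by fun_prop) (by rw [hleft, hright]; gcongr)
    filter_upwards [hfin, heq] with x hx hx'
    exact (ofReal_mul_le_rpow_add hq hx).2 hx'

end LayerCake

/-! ### The sharp inequality -/

section SharpInequality

variable {n : ℕ} {α : ℝ}

lemma chordSobolevConst_pos (hn : 1 ≤ n) (hα : 0 < α) : 0 < chordSobolevConst n α := by
  have hn' : (0 : ℝ) < n := Nat.cast_pos.2 hn
  have hG1 : 0 < Real.Gamma ((n : ℝ) / 2 + 1) := Real.Gamma_pos_of_pos (by positivity)
  have hG2 : 0 < Real.Gamma ((n + α) / 2 + 1) := Real.Gamma_pos_of_pos (by positivity)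
  have hG3 : 0 < Real.Gamma ((α + 1) / 2) := Real.Gamma_pos_of_pos (by positivity)
  have hG4 : 0 < Real.Gamma ((n : ℝ) / 2 + 1) ^ (α / n) := Real.rpow_pos_of_pos hG1 _
  have hπ := Real.pi_pos
  unfold chordSobolevConst
  positivity

lemma volume_superlevel_ne_top {g : EuclideanSpace ℝ (Fin n) → ℝ} (hg : Measurable g)
    (hL : ∫⁻ x, ENNReal.ofReal (g x) ≠ ∞) {t : ℝ} (ht : 0 < t) : volume {x | t < g x} ≠ ∞ := by
  have h := mul_meas_ge_le_lintegral (μ := volume) hg.ennreal_ofReal (ENNReal.ofReal t)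
  have h1 := ne_top_of_le_ne_top hL h
  refine measure_ne_top_of_subset (s := {x | ENNReal.ofReal t ≤ ENNReal.ofReal (g x)})
    (fun x hx => ENNReal.ofReal_le_ofReal (le_of_lt hx)) ?_
  exact (ENNReal.lt_top_of_mul_ne_top_right h1 (by simpa using ht)).ne

lemma setLIntegral_Ioo_volume_superlevel {g : EuclideanSpace ℝ (Fin n) → ℝ} (hg : Measurable g)
    (h0 : ∀ x, 0 ≤ g x) {M : ℝ} (hM0 : 0 < M) (hM : ∀ᵐ x, g x ≤ M) :
    ∫⁻ t in Set.Ioo 0 M, volume {x | t < g x} = ∫⁻ x, ENNReal.ofReal (g x) := by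
  rw [lintegral_eq_lintegral_meas_lt volume (Filter.Eventually.of_forall h0) hg.aemeasurable,
    ← Set.Ioo_union_Ici_eq_Ioi hM0, lintegral_union measurableSet_Ici]
  · rw [setLIntegral_congr_fun (g := fun _ => 0) measurableSet_Ici, lintegral_zero, add_zero]
    intro t ht
    refine measure_mono_null (fun x hx => ?_) hM
    have hx' : t < g x := hx
    exact not_le.2 (lt_of_le_of_lt ht hx')
  · exact Set.disjoint_left.2 fun t h1 h2 => not_le.2 h1.2 h2

/-- If almost every superlevel set below the height `M` is a ball of one and the same volume,
then the function is a multiple of the indicator of a ball. -/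
lemma ae_eq_indicator_closedBall_of_superlevel {g : EuclideanSpace ℝ (Fin n) → ℝ}
    (hg : Measurable g) (h0 : ∀ x, 0 ≤ g x) {M : ℝ} (hM0 : 0 < M) (hM : ∀ᵐ x, g x ≤ M)
    {a : ℝ≥0∞} (ha : a ≠ ∞)
    (hball : ∀ᵐ t : ℝ, t ∈ Set.Ioo 0 M → volume {x | t < g x} = a ∧
      ∃ (x₀ : EuclideanSpace ℝ (Fin n)) (r : ℝ), 0 < r ∧
        {x | t < g x} =ᵐ[volume] Metric.closedBall x₀ r) :
    ∃ (x₀ : EuclideanSpace ℝ (Fin n)) (r : ℝ), 0 < r ∧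
      g =ᵐ[volume] (Metric.closedBall x₀ r).indicator fun _ => M := by
  have hdense := Measure.dense_of_ae hball
  have hanti : Antitone fun t : ℝ => {x | t < g x} := fun s t hst x hx => lt_of_le_of_lt hst hx
  have hlevel : ∀ t ∈ Set.Ioo 0 M, volume {x | t < g x} = a := by
    intro t ht
    obtain ⟨s, hs, hs'⟩ := hdense.exists_between ht.1
    obtain ⟨s', hs₁, hs₁'⟩ := hdense.exists_between ht.2
    refine le_antisymm ?_ ?_
    · rw [← (hs ⟨hs'.1, hs'.2.trans ht.2⟩).1]
      exact measure_mono (hanti hs'.2.le)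
    · rw [← (hs₁ ⟨ht.1.trans hs₁'.1, hs₁'.2⟩).1]
      exact measure_mono (hanti hs₁'.1.le)
  obtain ⟨s, hs, hs'⟩ := hdense.exists_between hM0
  obtain ⟨-, x₀, r, hr, hB⟩ := hs hs'
  refine ⟨x₀, r, hr, ?_⟩
  have hsame : ∀ t ∈ Set.Ioo 0 M, {x | t < g x} =ᵐ[volume] Metric.closedBall x₀ r := by
    intro t ht
    refine Filter.EventuallyEq.trans ?_ hB
    have hmeas : ∀ t : ℝ, NullMeasurableSet {x | t < g x} := fun t =>
      (measurableSet_lt measurable_const hg).nullMeasurableSet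
    rcases le_total t s with hts | hts
    · exact (ae_eq_of_subset_of_measure_ge (hanti hts) (by rw [hlevel t ht, hlevel s hs'])
        (hmeas s) (by rw [hlevel t ht]; exact ha)).symm
    · exact ae_eq_of_subset_of_measure_ge (hanti hts) (by rw [hlevel t ht, hlevel s hs'])
        (hmeas t) (by rw [hlevel s hs']; exact ha)
  have hrat : ∀ᵐ x, ∀ t : ℚ, (t : ℝ) ∈ Set.Ioo 0 M →
      ((t : ℝ) < g x ↔ x ∈ Metric.closedBall x₀ r) := by
    refine ae_all_iff.2 fun t => ?_
    by_cases ht : (t : ℝ) ∈ Set.Ioo 0 M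
    · filter_upwards [Filter.eventuallyEq_set.1 (hsame t ht)] with x hx _
      exact hx
    · exact Filter.Eventually.of_forall fun x h => absurd h ht
  filter_upwards [hM, hrat] with x hxM hx
  by_cases hxB : x ∈ Metric.closedBall x₀ r
  · rw [Set.indicator_of_mem hxB]
    refine le_antisymm hxM (not_lt.1 fun hlt => ?_)
    obtain ⟨t, ht, ht'⟩ := exists_rat_btwn hlt
    exact lt_asymm ((hx t ⟨(h0 x).trans_lt ht, ht'⟩).2 hxB) ht
  · rw [Set.indicator_of_notMem hxB]
    refine le_antisymm (not_lt.1 fun hlt => ?_) (h0 x)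
    obtain ⟨t, ht, ht'⟩ := exists_rat_btwn hlt
    exact hxB ((hx t ⟨ht, ht'.trans_le hxM⟩).1 ht')

/-- The sharp inequality for a bounded integrable function with upper bound `M`, and the
description of the functions attaining it. -/
lemma chordSobolevConst_mul_le_minEnergy (hn : 1 ≤ n) (hα : (n : ℝ) < α)
    {g : EuclideanSpace ℝ (Fin n) → ℝ} (hg : Measurable g) (h0 : ∀ x, 0 ≤ g x) {M : ℝ}
    (hM0 : 0 < M) (hM : ∀ᵐ x, g x ≤ M) (hL0 : ∫⁻ x, ENNReal.ofReal (g x) ≠ 0)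
    (hL : ∫⁻ x, ENNReal.ofReal (g x) ≠ ∞) :
    ENNReal.ofReal (chordSobolevConst n α) *
        (∫⁻ x, ENNReal.ofReal (g x)) ^ (((n : ℝ) + α) / (n : ℝ)) *
        ENNReal.ofReal M ^ (-(α / (n : ℝ))) ≤ minEnergy n α g ∧
    (minEnergy n α g ≤ ENNReal.ofReal (chordSobolevConst n α) *
        (∫⁻ x, ENNReal.ofReal (g x)) ^ (((n : ℝ) + α) / (n : ℝ)) *
        ENNReal.ofReal M ^ (-(α / (n : ℝ))) →
      ∃ (x₀ : EuclideanSpace ℝ (Fin n)) (r : ℝ), 0 < r ∧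
        g =ᵐ[volume] (Metric.closedBall x₀ r).indicator fun _ => M) := by
  have hn' : (0 : ℝ) < n := Nat.cast_pos.2 hn
  have hα0 : 0 < α := hn'.trans hα
  have : Nontrivial (EuclideanSpace ℝ (Fin n)) :=
    Module.nontrivial_of_finrank_pos (R := ℝ) (by rwa [finrank_euclideanSpace_fin])
  set L := ∫⁻ x, ENNReal.ofReal (g x) with hLdef
  set q : ℝ := ((n : ℝ) + α) / n with hq
  have hq1 : 1 < q := by rw [hq, one_lt_div hn']; linarith
  have hq0 : 0 ≤ q := by linarith
  set M' := ENNReal.ofReal M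
  have hM'0 : M' ≠ 0 := by simpa [M'] using hM0
  have hM'top : M' ≠ ∞ := ENNReal.ofReal_ne_top
  -- the mean of the volumes of the superlevel sets over the heights `(0, M)`
  set a := L / M'
  have ha0 : a ≠ 0 := ENNReal.div_ne_zero.2 ⟨hL0, hM'top⟩
  have hatop : a ≠ ∞ := ENNReal.div_ne_top hL hM'0
  set σ := ENNReal.ofReal (chordSobolevConst n α)
  have hσ0 : σ ≠ 0 := by simpa [σ] using chordSobolevConst_pos hn hα0
  have hσtop : σ ≠ ∞ := ENNReal.ofReal_ne_top
  set c := σ * a ^ q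
  have hc0 : c ≠ 0 := mul_ne_zero hσ0 (by simp [ENNReal.rpow_eq_zero_iff, ha0, hatop])
  have hctop : c ≠ ∞ := ENNReal.mul_ne_top hσtop (ENNReal.rpow_ne_top_of_nonneg hq0 hatop)
  have hT : σ * L ^ q * M' ^ (-(α / (n : ℝ))) = c * M' := by
    have hexp : -(α / (n : ℝ)) = 1 - q := by rw [hq]; field_simp; ring
    rw [hexp, ENNReal.rpow_sub _ _ hM'0 hM'top, ENNReal.rpow_one]
    simp only [c, a]
    rw [ENNReal.div_rpow_of_nonneg _ _ hq0, div_eq_mul_inv, div_eq_mul_inv]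
    ring
  rw [hT]
  set m : ℝ → ℝ≥0∞ := fun t => volume {x | t < g x}
  have hm : Measurable m := by
    have : Antitone m := fun s t hst => measure_mono fun x hx => lt_of_le_of_lt hst hx
    exact this.measurable
  set μ := volume.restrict (Set.Ioo 0 M)
  have hμ : μ Set.univ = M' := by simp [μ, M']
  have : IsFiniteMeasure μ := ⟨by rw [hμ]; exact hM'top.lt_top⟩
  set u : ℝ → ℝ≥0∞ := fun t => m t * a⁻¹
  have hu : Measurable u := hm.mul_const _
  have hmu : ∀ t, m t = a * u t := fun t => by
    simp only [u]
    rw [mul_comm, mul_assoc, ENNReal.inv_mul_cancel ha0 hatop, mul_one]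
  have hufin : ∀ᵐ t ∂μ, u t ≠ ∞ := by
    filter_upwards [ae_restrict_mem measurableSet_Ioo] with t ht
    exact ENNReal.mul_ne_top (volume_superlevel_ne_top hg hL ht.1) (ENNReal.inv_ne_top.2 ha0)
  have humean : ∫⁻ t, u t ∂μ = μ Set.univ := by
    rw [lintegral_mul_const _ hm, setLIntegral_Ioo_volume_superlevel hg h0 hM0 hM, hμ, ← hLdef,
      ENNReal.inv_div (Or.inl hM'top) (Or.inl hM'0), ENNReal.mul_div_cancel hL0 hL]
  obtain ⟨hJ1, hJ2⟩ := measure_univ_le_lintegral_rpow hq1 hu hufin humean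
  rw [hμ] at hJ1 hJ2
  set J : ℝ → ℝ≥0∞ := fun t => rieszEnergy (α - n) {x | t < g x} {x | t < g x}
  have hJmeas : Measurable J := measurable_rieszEnergy_superlevel hg _
  have hset : ∀ t : ℝ, MeasurableSet {x | t < g x} := fun t => measurableSet_lt measurable_const hg
  have hcu : ∀ t, c * u t ^ q = σ * m t ^ q := fun t => by
    rw [hmu t, ENNReal.mul_rpow_of_nonneg a (u t) hq0, ← mul_assoc]
  have hRiesz : ∀ t, c * u t ^ q ≤ J t := fun t => by
    have h := chordSobolevConst_mul_volume_rpow_le_rieszEnergy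
      (E := EuclideanSpace ℝ (Fin n)) (α := α) (by rwa [finrank_euclideanSpace_fin]) (hset t)
    rw [finrank_euclideanSpace_fin] at h
    rw [hcu]
    exact h
  have hcint : ∫⁻ t, c * u t ^ q ∂μ = c * ∫⁻ t, u t ^ q ∂μ :=
    lintegral_const_mul _ (hu.pow_const q)
  have hchain1 : c * ∫⁻ t, u t ^ q ∂μ ≤ ∫⁻ t, J t ∂μ := by
    rw [← hcint]
    exact lintegral_mono hRiesz
  have hchain2 : ∫⁻ t, J t ∂μ ≤ minEnergy n α g := by
    rw [minEnergy_eq_lintegral_rieszEnergy hg h0]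
    exact lintegral_mono_set Set.Ioo_subset_Ioi_self
  refine ⟨(mul_le_mul_right hJ1 c).trans (hchain1.trans hchain2), fun hle => ?_⟩
  have hJle : ∫⁻ t, J t ∂μ ≤ c * M' := hchain2.trans hle
  have hu1 : ∀ᵐ t ∂μ, u t = 1 :=
    hJ2 ((ENNReal.mul_le_mul_iff_right hc0 hctop).1 (hchain1.trans hJle))
  have hcM : c * M' ≤ ∫⁻ t, c * u t ^ q ∂μ := hcint ▸ mul_le_mul_right hJ1 c
  have hJeq : (fun t => c * u t ^ q) =ᵐ[μ] J :=
    ae_eq_of_ae_le_of_lintegral_le (Filter.Eventually.of_forall hRiesz)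
      (ne_top_of_le_ne_top (ENNReal.mul_ne_top hctop hM'top)
        (hcint ▸ hchain1.trans hJle)) hJmeas.aemeasurable (hJle.trans hcM)
  refine ae_eq_indicator_closedBall_of_superlevel hg h0 hM0 hM hatop
    ((ae_restrict_iff' measurableSet_Ioo).1 ?_)
  filter_upwards [hu1, hJeq] with t ht1 ht2
  have hmt : m t = a := by rw [hmu, ht1, mul_one]
  refine ⟨hmt, exists_ae_eq_closedBall_of_rieszEnergy_le (α := α)
    (by rwa [finrank_euclideanSpace_fin]) (hset t) (hmt.trans_ne ha0) (hmt.trans_ne hatop) ?_⟩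
  rw [finrank_euclideanSpace_fin]
  exact (ht2.symm.trans (hcu t)).le

/-- The energy of a multiple of the indicator of a ball. -/
lemma minEnergy_indicator_closedBall (hn : 1 ≤ n) (hα : 0 < α) {c : ℝ} (hc : 0 < c)
    (x₀ : EuclideanSpace ℝ (Fin n)) {r : ℝ} (hr : 0 < r) :
    minEnergy n α ((Metric.closedBall x₀ r).indicator fun _ => c) =
      ENNReal.ofReal c * (ENNReal.ofReal (chordSobolevConst n α) *
        volume (Metric.closedBall x₀ r) ^ (((n : ℝ) + α) / (n : ℝ))) := by
  have : Nontrivial (EuclideanSpace ℝ (Fin n)) :=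
    Module.nontrivial_of_finrank_pos (R := ℝ) (by rwa [finrank_euclideanSpace_fin])
  have hB : MeasurableSet (Metric.closedBall x₀ r) := Metric.isClosed_closedBall.measurableSet
  have hE := rieszEnergy_closedBall hα x₀ hr
  rw [finrank_euclideanSpace_fin] at hE
  rw [minEnergy_eq_lintegral_rieszEnergy (measurable_const.indicator hB)
    (fun x => Set.indicator_nonneg (fun _ _ => hc.le) x), ← hE]
  have hlevel : ∀ t ∈ Set.Ioi (0 : ℝ), rieszEnergy (α - n)
      {x | t < (Metric.closedBall x₀ r).indicator (fun _ => c) x}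
      {x | t < (Metric.closedBall x₀ r).indicator (fun _ => c) x} =
      (Set.Iio c).indicator (fun _ => rieszEnergy (α - n) (Metric.closedBall x₀ r)
        (Metric.closedBall x₀ r)) t := by
    intro t ht
    have ht0 : ¬ t < 0 := not_lt.2 (le_of_lt ht)
    by_cases htc : t < c
    · rw [Set.indicator_of_mem (Set.mem_Iio.2 htc)]
      congr 1 <;>
      · ext x
        by_cases hx : x ∈ Metric.closedBall x₀ r
        · simp only [Set.mem_ofPred_eq, Set.indicator_of_mem hx, htc, hx]
        · simp only [Set.mem_ofPred_eq, Set.indicator_of_notMem hx, ht0, hx]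
    · rw [Set.indicator_of_notMem (by simpa using htc)]
      have hempty : {x | t < (Metric.closedBall x₀ r).indicator (fun _ => c) x} = ∅ := by
        ext x
        by_cases hx : x ∈ Metric.closedBall x₀ r
        · simp only [Set.mem_ofPred_eq, Set.indicator_of_mem hx, htc, Set.mem_empty_iff_false]
        · simp only [Set.mem_ofPred_eq, Set.indicator_of_notMem hx, ht0, Set.mem_empty_iff_false]
      rw [hempty]
      simp [rieszEnergy]
  rw [setLIntegral_congr_fun measurableSet_Ioi hlevel, lintegral_indicator measurableSet_Iio,
    setLIntegral_const, Measure.restrict_apply measurableSet_Iio, Set.Iio_inter_Ioi,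
    Real.volume_Ioo, sub_zero, mul_comm]

theorem mainTheorem4 (n : ℕ) (hn : 1 ≤ n) (α : ℝ) (hα : (n : ℝ) < α)
    (f : EuclideanSpace ℝ (Fin n) → ℝ)
    (hf_nonneg : 0 ≤ᵐ[volume] f) (hf_nonzero : ¬ f =ᵐ[volume] 0)
    (hf_one : MemLp f 1 volume) (hf_top : MemLp f ∞ volume) :
    ENNReal.ofReal (chordSobolevConst n α) *
        eLpNorm f 1 volume ^ (((n : ℝ) + α) / (n : ℝ)) *
        eLpNorm f ∞ volume ^ (-(α / (n : ℝ))) ≤ minEnergy n α f ∧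
    (ENNReal.ofReal (chordSobolevConst n α) *
        eLpNorm f 1 volume ^ (((n : ℝ) + α) / (n : ℝ)) *
        eLpNorm f ∞ volume ^ (-(α / (n : ℝ))) = minEnergy n α f ↔
      ∃ (c : ℝ) (x₀ : EuclideanSpace ℝ (Fin n)) (r : ℝ), 0 < c ∧ 0 < r ∧
        f =ᵐ[volume] (Metric.closedBall x₀ r).indicator (fun _ => c)) := by
  have hn' : (0 : ℝ) < n := Nat.cast_pos.2 hn
  have hα0 : 0 < α := hn'.trans hα
  have hmeas := hf_one.aestronglyMeasurable
  -- a measurable representative that is nonnegative everywhere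
  set g : EuclideanSpace ℝ (Fin n) → ℝ := fun x => max (hmeas.mk f x) 0
  have hg : Measurable g := hmeas.stronglyMeasurable_mk.measurable.max measurable_const
  have hg0 : ∀ x, 0 ≤ g x := fun x => le_max_right _ _
  have hfg : f =ᵐ[volume] g := by
    filter_upwards [hmeas.ae_eq_mk, hf_nonneg] with x hx hx0
    simp only [g, ← hx]
    exact (max_eq_left hx0).symm
  have hL : eLpNorm f 1 volume = ∫⁻ x, ENNReal.ofReal (g x) := by
    rw [eLpNorm_congr_ae hfg, eLpNorm_one_eq_lintegral_enorm]
    exact lintegral_congr fun x => Real.enorm_of_nonneg (hg0 x)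
  have hM0 : eLpNorm f ∞ volume ≠ 0 := fun h =>
    hf_nonzero ((eLpNorm_eq_zero_iff hmeas ENNReal.top_ne_zero).1 h)
  have hMtop : eLpNorm f ∞ volume ≠ ∞ := hf_top.eLpNorm_ne_top
  have hL0 : eLpNorm f 1 volume ≠ 0 := fun h =>
    hf_nonzero ((eLpNorm_eq_zero_iff hmeas one_ne_zero).1 h)
  have hMpos : 0 < (eLpNorm f ∞ volume).toReal := ENNReal.toReal_pos hM0 hMtop
  have hM : ∀ᵐ x, g x ≤ (eLpNorm f ∞ volume).toReal := by
    have h := ae_le_eLpNormEssSup (f := f) (μ := volume)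
    filter_upwards [h, hfg] with x hx hxg
    rw [hxg, Real.enorm_of_nonneg (hg0 x), ← eLpNorm_exponent_top,
      ENNReal.ofReal_le_iff_le_toReal hMtop] at hx
    exact hx
  have key := chordSobolevConst_mul_le_minEnergy hn hα hg hg0 hMpos hM (hL ▸ hL0)
    (hL ▸ hf_one.eLpNorm_ne_top)
  rw [← hL, ENNReal.ofReal_toReal hMtop, ← minEnergy_congr hfg] at key
  refine ⟨key.1, fun h => ?_, ?_⟩
  · obtain ⟨x₀, r, hr, h⟩ := key.2 h.ge
    exact ⟨_, x₀, r, hMpos, hr, hfg.trans h⟩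
  · rintro ⟨c, x₀, r, hc, hr, h⟩
    have hB : MeasurableSet (Metric.closedBall x₀ r) := Metric.isClosed_closedBall.measurableSet
    have hB0 : volume (Metric.closedBall x₀ r) ≠ 0 := (Metric.measure_closedBall_pos _ _ hr).ne'
    have hc0 : ENNReal.ofReal c ≠ 0 := by simpa using hc
    have hq0 : 0 ≤ ((n : ℝ) + α) / (n : ℝ) := by positivity
    rw [minEnergy_congr h, minEnergy_indicator_closedBall hn hα0 hc x₀ hr, eLpNorm_congr_ae h,
      eLpNorm_congr_ae h, eLpNorm_indicator_const hB one_ne_zero ENNReal.one_ne_top,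
      eLpNorm_exponent_top, eLpNormEssSup_indicator_const_eq _ _ hB0, Real.enorm_of_nonneg hc.le,
      ENNReal.toReal_one, div_one, ENNReal.rpow_one, ENNReal.mul_rpow_of_nonneg _ _ hq0]
    have hpow : ENNReal.ofReal c ^ (((n : ℝ) + α) / (n : ℝ)) * ENNReal.ofReal c ^ (-(α / (n : ℝ))) =
        ENNReal.ofReal c := by
      rw [← ENNReal.rpow_add _ _ hc0 ENNReal.ofReal_ne_top]
      conv_rhs => rw [← ENNReal.rpow_one (ENNReal.ofReal c)]
      congr 1
      field_simp
      ring
    calc _ = (ENNReal.ofReal c ^ (((n : ℝ) + α) / (n : ℝ)) *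
          ENNReal.ofReal c ^ (-(α / (n : ℝ)))) * (ENNReal.ofReal (chordSobolevConst n α) *
          volume (Metric.closedBall x₀ r) ^ (((n : ℝ) + α) / (n : ℝ))) := by ring
      _ = _ := by rw [hpow]

end SharpInequality
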